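/- For $m\ge 1$, $n\ge 0$ let $\Delta^m_n$ be the graph with vertices $a$, $b$, $1,\dots,n$ and $(j,k)$ for $1\le j\le m$, $1\le k\le n+1$, and with the following edges, for every $j$: $\{a,(j,1)\}$, $\{(j,n+1),b\}$, $\{(j,k),(j,k+1)\}$, $\{k,(j,k)\}$ and $\{k,(j,k+1)\}$ for $1\le k\le n$. Let $\mathrm{Ind}(\Delta^m_n)$ be its independence complex, whose faces are the sets of pairwise non-adjacent vertices. The Comb Algorithm is the following matching tree for $\mathrm{Ind}(\Delta^m_n)$. Decide successively, for $k=1,\dots,n$, whether the vertex $k$ belongs to the independent set; once a vertex is included, its neighbours are excluded. - If $k$ is the first of these vertices to be included, then for $k=1$ the vertex $a$ is free, and for $k=n>1$ the vertex $b$ is free. For $1<k<n$ there remains the disjoint union of an extended star with centre $a$ and $m$ tendrils of $k-1$ vertices and a copy of $\Delta^m_{n-k-1}$. The star is treated by its standard matching tree (if $3\mid k-1$, match each tendril from its leaf, after which $a$ is free; otherwise decide $a$ and treat the remaining paths from an end), followed by the Comb Algorithm for $\Delta^m_{n-k-1}$. - If none of $1,\dots,n$ is included (in particular if $n=0$), then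 $a$, $b$ and the $m$ paths between them remain; decide $b$ and treat the remaining extended star with centre $a$ as above. At a node with a free vertex $p$, the faces $\sigma$ and $\sigma\cup\{p\}$ are matched. The faces that remain unmatched are critical. Let $X^m_n$ be the resulting Morse complex, whose cells are the critical faces together with the $0$-cell matched with the empty face, and whose boundary maps count gradient paths with signs; it is homotopy equivalent to $\mathrm{Ind}(\Delta^m_n)$. Let $C^d_n$ be the number of critical faces of dimension $d$. **Theorem.** Let $m\ge 4$, $n\ge 0$ and $d_n=\left\lfloor\frac{2n+2}{3}\right\rfloor$. 1. If $n\equiv 0$ or $1 \pmod 3$, then $\widetilde H_{d_n}(X^m_n;\mathbb Z)\cong\mathbb Z$ and $\widetilde H_{d_n}(\mathrm{Ind}(\Delta^m_n);\mathbb Z)\cong\mathbb Z$. Moreover $C^{d_n}_n=1$ and $C^{d_n-1}_n=C^{d_n+1}_n=0$. 2. If $n\equiv 2\pmod 3$, then $\widetilde H_{d_n}(X^m_n;\mathbb Z)=0$ and $\widetilde H_{d_n}(\mathrm{Ind}(\Delta^m_n);\mathbb Z)=0$. Moreover $C^{d_n}_n=0$. Here $\widetilde H$ is reduced homology; for $n\ge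 1$ we have $d_n\ge 1$ and it agrees with ordinary homology. -/

import Mathlib

open CategoryTheory

/-! ## The graphs -/

/-- Vertices of the graph `Δ^m_n`.  The vertex `spine k`, `0 ≤ k ≤ n + 1`, is the vertex `a` for
`k = 0`, the additional vertex `k` for `1 ≤ k ≤ n`, and the vertex `b` for `k = n + 1`.
The vertex `path j i` is the vertex `(j + 1, i + 1)`, i.e. the `(i + 1)`-st vertex after `a`
on the `(j + 1)`-st of the `m` paths from `a` to `b`. -/
inductive DeltaVertex (m n : ℕ) : Type
  | spine (k : Fin (n + 2)) : DeltaVertex m n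
  | path (j : Fin m) (i : Fin (n + 1)) : DeltaVertex m n

namespace DeltaVertex

/-- The vertices as a lexicographically ordered disjoint union. -/
def equivLex (m n : ℕ) : DeltaVertex m n ≃ (Fin (n + 2) ⊕ₗ (Fin m ×ₗ Fin (n + 1))) where
  toFun v := match v with
    | spine k => toLex (Sum.inl k)
    | path j i => toLex (Sum.inr (toLex (j, i)))
  invFun v := match ofLex v with
    | Sum.inl k => spine k
    | Sum.inr p => path (ofLex p).1 (ofLex p).2
  left_inv v := by cases v <;> rfl
  right_inv v := by rcases v with k | p <;> rfl

/-- A total order on the vertices; it only serves to orient simplices. -/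
noncomputable instance (m n : ℕ) : LinearOrder (DeltaVertex m n) :=
  LinearOrder.lift' (equivLex m n) (equivLex m n).injective

instance (m n : ℕ) : Fintype (DeltaVertex m n) :=
  Fintype.ofEquiv (Fin (n + 2) ⊕ (Fin m × Fin (n + 1)))
    { toFun := fun v => match v with
        | Sum.inl k => spine k
        | Sum.inr p => path p.1 p.2
      invFun := fun v => match v with
        | spine k => Sum.inl k
        | path j i => Sum.inr (j, i)
      left_inv := fun v => by rcases v with k | p <;> rfl
      right_inv := fun v => by cases v <;> rfl }

end DeltaVertex

/-- The edges of `Δ^m_n`, each listed in one direction: consecutive vertices of a path are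
adjacent; `a` is adjacent to the first and `b` to the last vertex of each path; and the
additional vertex `k` is adjacent to `(j, k)` and `(j, k + 1)` for every `j`. -/
def deltaRel (m n : ℕ) : DeltaVertex m n → DeltaVertex m n → Prop
  | .path j i, .path j' i' => j = j' ∧ (i' : ℕ) = i + 1
  | .spine k, .path _ i => k = i.castSucc ∨ k = i.succ
  | _, _ => False

/-- The graph `Δ^m_n`, for `n ≥ 0`. -/
def deltaGraph (m n : ℕ) : SimpleGraph (DeltaVertex m n) :=
  SimpleGraph.fromRel (deltaRel m n)

/-! ## Matching trees -/

/-- The shape of a matching tree on a vertex set `V`.  Each position in the tree carries a node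
`Σ(A, B)`, the set of independent sets that contain `A` and avoid `B`; the root is `Σ(∅, ∅)`.
* `leaf`: the node is not refined any further;
* `free p`: the free vertex `p` is used to pair all `σ` and `σ ∪ {p}` in the node;
* `split v l r`: the node is split at `v`, where `l` continues at `Σ(A, B ∪ {v})` and `r` at
  `Σ(A ∪ {v}, B ∪ N(v))`. -/
inductive MatchingTree (V : Type*)
  | leaf : MatchingTree V
  | free (p : V) : MatchingTree V
  | split (v : V) (l r : MatchingTree V) : MatchingTree V

namespace MatchingTree

variable {V : Type*}

/-- The step with a matching vertex `v` with respect to `p`, where `v` is the only neighbour of `p`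
that is still undecided: split at `v`; then `p` is a free vertex of the branch without `v`. -/
def pair (p v : V) (t : MatchingTree V) : MatchingTree V := split v (free p) t

/-- The matching tree for a path, given by the list of its consecutive vertices: take the first
vertex as `p` and the second as `v`, which decides the first three vertices, and repeat; a single
remaining vertex is free.  Below a critical cell of the path, the tree continues with `t`. -/
def pathTree : List V → MatchingTree V → MatchingTree V
  | [], t => t
  | [x], _ => free x
  | [x, y], t => pair x y t
  | x :: y :: _ :: l, t => pair x y (pathTree l t)

/-- The matching tree for a disjoint union of paths, continuing with `t` below a critical cell. -/
def pathsTree (ls : List (List V)) (t : MatchingTree V) : MatchingTree V :=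
  ls.foldr pathTree t

/-- The matching tree for the extended star with centre `c` and the given tendrils, all with `len`
vertices listed from the centre outwards.  If `3 ∣ len`, the tendrils are matched from their ends,
which leaves `c` as a free vertex.  Otherwise the tree splits at `c` and treats the resulting
disjoint unions of paths.  Below a critical cell of the star, the tree continues with `t`. -/
def starTree (c : V) (tendrils : List (List V)) (len : ℕ) (t : MatchingTree V) : MatchingTree V :=
  if len % 3 = 0 then pathsTree (tendrils.map List.reverse) (free c)
  else split c (pathsTree tendrils t) (pathsTree (tendrils.map List.tail) t)

/-- The matching tree for the graph that consists of vertices `a` and `b` and disjoint paths between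
them, with `len` inner vertices each, listed from `a` to `b`: split at `b`, which leaves an extended
star with centre `a` in each branch. -/
def hatTree (a b : V) (paths : List (List V)) (len : ℕ) : MatchingTree V :=
  split b (starTree a paths len leaf) (starTree a (paths.map List.dropLast) (len - 1) leaf)

section

variable [DecidableEq V]

/-- The number of terminal nodes (without children other than the empty node). -/
def numTerminals : MatchingTree V → ℕ
  | leaf => 1
  | free _ => 1
  | split _ l r => l.numTerminals + r.numTerminals

/-- The terminal node in which the set `σ` ends up when it is sorted down the tree; the terminal
nodes are numbered from left to right. -/
def terminal : MatchingTree V → Finset V → ℕ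
  | leaf, _ => 0
  | free _, _ => 0
  | split v l r, σ => if v ∈ σ then l.numTerminals + r.terminal σ else l.terminal σ

/-- The free vertex, if any, of the terminal node in which `σ` ends up. -/
def freeVertex : MatchingTree V → Finset V → Option V
  | leaf, _ => none
  | free p, _ => some p
  | split v l r, σ => if v ∈ σ then r.freeVertex σ else l.freeVertex σ

/-- The partial matching on the face poset of the independence complex of `G` (which includes the
empty face) given by the matching tree: `α` is matched with `β = α ∪ {p}`
if both lie in the same terminal node and `p` is the free vertex of that node. -/
def Matched (G : SimpleGraph V) (t : MatchingTree V) (α β : Finset V) : Prop :=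
  G.IsIndepSet (α : Set V) ∧ G.IsIndepSet (β : Set V) ∧ t.terminal α = t.terminal β ∧
    ∃ p, t.freeVertex α = some p ∧ p ∉ α ∧ β = insert p α

/-- A face of the independence complex is critical if it is unmatched. -/
def Critical (G : SimpleGraph V) (t : MatchingTree V) (σ : Finset V) : Prop :=
  G.IsIndepSet (σ : Set V) ∧ ∀ ρ, ¬ Matched G t σ ρ ∧ ¬ Matched G t ρ σ

end

/-! ### The Comb Algorithm -/

/-- The vertex `spine k`. -/
def spineVertex (m n k : ℕ) : DeltaVertex m n := .spine (Fin.ofNat (n + 2) k)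

/-- For every `j`, the list of the vertices `path j i` with `lo ≤ i < hi`. -/
def pathSegments (m n lo hi : ℕ) : List (List (DeltaVertex m n)) :=
  (List.finRange m).map fun j =>
    ((List.finRange (n + 1)).filter fun i : Fin (n + 1) => decide (lo ≤ (i : ℕ) ∧ (i : ℕ) < hi)).map
      fun i => .path j i

/-- The Comb Algorithm for the copy of `Δ^m_{n-s}` inside `Δ^m_n` on the vertices `spine k` with
`s ≤ k` and `path j i` with `s ≤ i`, in which `spine s` plays the role of `a`, from the stage on at
which the vertices `spine (s + 1), …, spine (k - 1)` have been excluded.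

If `k ≤ n`, split at `spine k`.  In the branch with `spine k`: if `k = s + 1`, then `spine s` is
free; otherwise, if `k = n`, then `b` is free; otherwise there remain an extended star with centre
`spine s`, with `k - 1 - s` vertices on each tendril, and a copy of `Δ^m_{n-(k+1)}`, to which the
Comb Algorithm is applied inductively.  Once `k = n + 1`, what remains are `spine s`, `b` and the
`m` paths between them. -/
def combTreeFrom (m n s k : ℕ) : MatchingTree (DeltaVertex m n) :=
  if k ≤ n then
    split (spineVertex m n k)
      (combTreeFrom m n s (k + 1))
      (if k = s + 1 then free (spineVertex m n s)
        else if k = n then free (spineVertex m n (n + 1))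
        else starTree (spineVertex m n s) (pathSegments m n s (k - 1)) (k - 1 - s)
          (combTreeFrom m n (k + 1) (k + 2)))
  else
    hatTree (spineVertex m n s) (spineVertex m n (n + 1)) (pathSegments m n s (n + 1)) (n + 1 - s)
termination_by n + 1 - k

/-- The matching tree of the Comb Algorithm for `Δ^m_n`. -/
def combTree (m n : ℕ) : MatchingTree (DeltaVertex m n) := combTreeFrom m n 0 1

end MatchingTree

/-! ## Simplicial chains and the Morse complex -/

section Chains

variable {V : Type*} [LinearOrder V]

/-- The sign of the face `σ \ {v}` in the boundary of the simplex `σ`, oriented by the order. -/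
def faceSign (σ : Finset V) (v : V) : ℤ := (-1) ^ (σ.filter (· < v)).card

/-- The augmented simplicial boundary map on integral chains of finite subsets of `V`; the boundary
of a vertex is the empty face. -/
noncomputable def simplexBoundary (V : Type*) [LinearOrder V] :
    (Finset V →₀ ℤ) →ₗ[ℤ] (Finset V →₀ ℤ) :=
  Finsupp.linearCombination ℤ fun σ =>
    ∑ v ∈ σ, Finsupp.single (σ.erase v) (faceSign σ v)

/-- The chains of dimension `c - 1` of the independence complex of `G`. -/
noncomputable def faceChains (G : SimpleGraph V) (c : ℕ) : Submodule ℤ (Finset V →₀ ℤ) :=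
  Finsupp.supported ℤ ℤ {σ | G.IsIndepSet (σ : Set V) ∧ σ.card = c}

namespace MatchingTree

/-- The critical chains of dimension `c - 1`: the free module on the critical faces with
`c` vertices. -/
noncomputable def criticalChains (G : SimpleGraph V) (t : MatchingTree V) (c : ℕ) :
    Submodule ℤ (Finset V →₀ ℤ) :=
  Finsupp.supported ℤ ℤ {σ | t.Critical G σ ∧ σ.card = c}

open Classical in
/-- One step along gradient paths: a face `α` that is matched with `β = α ∪ {p}` is sent to
`∑ -[β : α] [β : α'] α'`, where `α'` runs over the facets of `β` other than `α`; all other faces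
are sent to zero. -/
noncomputable def gradientStep (G : SimpleGraph V) (t : MatchingTree V) :
    (Finset V →₀ ℤ) →ₗ[ℤ] (Finset V →₀ ℤ) :=
  Finsupp.linearCombination ℤ fun α =>
    match t.freeVertex α with
    | none => 0
    | some p =>
      if t.Matched G α (insert p α) then
        ∑ v ∈ α, Finsupp.single ((insert p α).erase v)
          (-(faceSign (insert p α) p * faceSign (insert p α) v))
      else 0

/-- The sum over all gradient paths starting at a given face.  Along a gradient path the terminal
node moves strictly to the left, so that no path has more than `numTerminals` steps; see
`gradientStep_pow_eq_zero`. -/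
noncomputable def gradientPathSum (G : SimpleGraph V) (t : MatchingTree V) :
    (Finset V →₀ ℤ) →ₗ[ℤ] (Finset V →₀ ℤ) :=
  ∑ r ∈ Finset.range (t.numTerminals + 1), t.gradientStep G ^ r

open Classical in
/-- The projection onto the critical chains. -/
noncomputable def criticalProj (G : SimpleGraph V) (t : MatchingTree V) :
    (Finset V →₀ ℤ) →ₗ[ℤ] (Finset V →₀ ℤ) :=
  Finsupp.linearCombination ℤ fun σ => if t.Critical G σ then Finsupp.single σ 1 else 0

/-- The Morse boundary: the coefficient of a critical face `τ` in the boundary of a critical face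
`σ` is the signed number of gradient paths from the facets of `σ` to `τ`. -/
noncomputable def morseBoundary (G : SimpleGraph V) (t : MatchingTree V) :
    (Finset V →₀ ℤ) →ₗ[ℤ] (Finset V →₀ ℤ) :=
  t.criticalProj G ∘ₗ t.gradientPathSum G ∘ₗ simplexBoundary V

/-! ### Both boundary maps square to zero -/

end MatchingTree

theorem simplexBoundary_single (σ : Finset V) :
    simplexBoundary V (Finsupp.single σ 1) =
      ∑ v ∈ σ, Finsupp.single (σ.erase v) (faceSign σ v) := by
  simp [simplexBoundary, Finsupp.linearCombination_single]

theorem faceSign_mul_self (σ : Finset V) (v : V) : faceSign σ v * faceSign σ v = 1 := by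
  unfold faceSign
  rw [← pow_add, ← two_mul, pow_mul]
  simp

theorem faceSign_erase_of_lt {σ : Finset V} {v w : V} (h : v < w) :
    faceSign (σ.erase w) v = faceSign σ v := by
  unfold faceSign
  congr 2
  ext x
  simp only [Finset.mem_filter, Finset.mem_erase]
  constructor
  · rintro ⟨⟨_, h1⟩, h2⟩
    exact ⟨h1, h2⟩
  · rintro ⟨h1, h2⟩
    exact ⟨⟨(h2.trans h).ne, h1⟩, h2⟩

theorem faceSign_erase_of_gt {σ : Finset V} {v w : V} (hw : w ∈ σ) (h : w < v) :
    faceSign (σ.erase w) v = -faceSign σ v := by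
  unfold faceSign
  have h1 : σ.filter (· < v) = insert w ((σ.erase w).filter (· < v)) := by
    ext x
    simp only [Finset.mem_filter, Finset.mem_erase, Finset.mem_insert]
    constructor
    · rintro ⟨h1, h2⟩
      by_cases hx : x = w
      · exact Or.inl hx
      · exact Or.inr ⟨⟨hx, h1⟩, h2⟩
    · rintro (rfl | ⟨⟨_, h1⟩, h2⟩)
      · exact ⟨hw, h⟩
      · exact ⟨h1, h2⟩
  rw [h1, Finset.card_insert_of_notMem (by simp), pow_succ]
  ring

theorem simplexBoundary_comp_self : simplexBoundary V ∘ₗ simplexBoundary V = 0 := by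
  apply Finsupp.lhom_ext'
  intro σ
  apply LinearMap.ext_ring
  simp only [LinearMap.comp_apply, Finsupp.lsingle_apply, LinearMap.zero_apply]
  rw [simplexBoundary_single, map_sum]
  have h1 : ∀ v ∈ σ, simplexBoundary V (Finsupp.single (σ.erase v) (faceSign σ v)) =
      ∑ w ∈ σ.erase v, Finsupp.single ((σ.erase v).erase w)
        (faceSign σ v * faceSign (σ.erase v) w) := by
    intro v _
    simp [simplexBoundary, Finsupp.linearCombination_single, Finset.smul_sum]
  rw [Finset.sum_congr rfl h1, Finset.sum_sigma']
  refine Finset.sum_involution (fun x _ => ⟨x.2, x.1⟩) ?_ ?_ ?_ ?_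
  · rintro ⟨v, w⟩ hx
    simp only [Finset.mem_sigma, Finset.mem_erase] at hx
    obtain ⟨hv, hwv, hw⟩ := hx
    simp only [Finset.erase_right_comm (a := w) (b := v), ← Finsupp.single_add]
    rcases lt_or_gt_of_ne hwv with h | h
    · rw [faceSign_erase_of_lt h, faceSign_erase_of_gt hw h]
      simp [mul_comm]
    · rw [faceSign_erase_of_lt h, faceSign_erase_of_gt hv h]
      simp [mul_comm]
  · rintro ⟨v, w⟩ hx _ h
    simp only [Finset.mem_sigma, Finset.mem_erase] at hx
    simp only [Sigma.mk.injEq, heq_eq_eq] at h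
    exact hx.2.1 h.1
  · rintro ⟨v, w⟩ hx
    simp only [Finset.mem_sigma, Finset.mem_erase] at hx ⊢
    exact ⟨hx.2.2, hx.2.1.symm, hx.1⟩
  · rintro ⟨v, w⟩ _
    rfl

/-- A linear map that is controlled on basis elements maps chains to chains. -/
theorem map_supported_le {V : Type*} {s : Set (Finset V)} {P : Submodule ℤ (Finset V →₀ ℤ)}
    {f : (Finset V →₀ ℤ) →ₗ[ℤ] (Finset V →₀ ℤ)}
    (h : ∀ σ ∈ s, f (Finsupp.single σ 1) ∈ P) :
    ∀ x ∈ Finsupp.supported ℤ ℤ s, f x ∈ P := by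
  intro x hx
  rw [Finsupp.supported_eq_span_single] at hx
  have hle : Submodule.span ℤ ((fun i => Finsupp.single i (1 : ℤ)) '' s) ≤ P.comap f := by
    rw [Submodule.span_le]
    rintro _ ⟨σ, hσ, rfl⟩
    exact h σ hσ
  exact hle hx

theorem simplexBoundary_mem (G : SimpleGraph V) (c : ℕ) :
    ∀ x ∈ faceChains G (c + 1), simplexBoundary V x ∈ faceChains G c := by
  apply map_supported_le
  rintro σ ⟨hσ, hc⟩
  rw [simplexBoundary_single]
  refine Submodule.sum_mem _ fun v hv => Finsupp.single_mem_supported ℤ _ ⟨?_, ?_⟩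
  · exact hσ.mono (by simp)
  · rw [Finset.card_erase_of_mem hv, hc]
    rfl

namespace MatchingTree

theorem terminal_lt (t : MatchingTree V) (σ : Finset V) : t.terminal σ < t.numTerminals := by
  induction t with
  | leaf => simp [terminal, numTerminals]
  | free p => simp [terminal, numTerminals]
  | split v l r hl hr =>
    simp only [terminal, numTerminals]
    split_ifs <;> omega

theorem freeVertex_eq (t : MatchingTree V) {σ ρ : Finset V} (h : t.terminal σ = t.terminal ρ) :
    t.freeVertex σ = t.freeVertex ρ := by
  induction t with
  | leaf => rfl
  | free p => rfl
  | split v l r hl hr =>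
    have h1 := l.terminal_lt σ
    have h2 := l.terminal_lt ρ
    simp only [terminal] at h
    simp only [freeVertex]
    split_ifs at h ⊢
    · exact hr (by omega)
    · omega
    · omega
    · exact hl h

theorem terminal_erase_le (t : MatchingTree V) (σ : Finset V) (w : V) :
    t.terminal (σ.erase w) ≤ t.terminal σ := by
  induction t with
  | leaf => exact le_rfl
  | free p => exact le_rfl
  | split v l r hl hr =>
    have h1 := l.terminal_lt (σ.erase w)
    simp only [terminal]
    split_ifs with h2 h3
    · omega
    · exact absurd (Finset.mem_of_mem_erase h2) h3
    · omega
    · exact hl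

variable (G : SimpleGraph V) (t : MatchingTree V)

variable {G t} in
theorem Matched.not_right {α β ρ : Finset V} (h : t.Matched G α β) : ¬ t.Matched G ρ α := by
  rintro ⟨_, _, h1, q, hq, hq', rfl⟩
  obtain ⟨_, _, _, p, hp, hp', rfl⟩ := h
  rw [← t.freeVertex_eq h1, hq] at hp
  obtain rfl := Option.some.inj hp
  simp at hp'

variable {G t} in
theorem Matched.eq_insert {α β : Finset V} {p : V} (h : t.Matched G α β)
    (hp : t.freeVertex α = some p) : β = insert p α ∧ p ∉ α := by
  obtain ⟨_, _, _, q, hq, hq', rfl⟩ := h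
  rw [hq] at hp
  obtain rfl := Option.some.inj hp
  exact ⟨rfl, hq'⟩

theorem gradientStep_of_not_matched {α : Finset V} (h : ∀ β, ¬ t.Matched G α β) :
    t.gradientStep G (Finsupp.single α 1) = 0 := by
  simp only [gradientStep, Finsupp.linearCombination_single, one_smul]
  split
  · rfl
  · rw [if_neg (h _)]

theorem gradientStep_of_matched {α : Finset V} {p : V} (hp : t.freeVertex α = some p)
    (h : t.Matched G α (insert p α)) :
    t.gradientStep G (Finsupp.single α 1) =
      ∑ v ∈ α, Finsupp.single ((insert p α).erase v)
        (-(faceSign (insert p α) p * faceSign (insert p α) v)) := by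
  simp only [gradientStep, Finsupp.linearCombination_single, one_smul, hp]
  rw [if_pos h]

theorem simplexBoundary_of_matched {α : Finset V} {p : V} (hp : t.freeVertex α = some p)
    (h : t.Matched G α (insert p α)) :
    simplexBoundary V (Finsupp.single (insert p α) 1) =
      faceSign (insert p α) p •
        (Finsupp.single α 1 - t.gradientStep G (Finsupp.single α 1)) := by
  have hpα := (h.eq_insert hp).2
  rw [simplexBoundary_single, gradientStep_of_matched G t hp h, Finset.sum_insert hpα,
    Finset.erase_insert hpα, smul_sub, sub_eq_add_neg]
  congr 1
  · simp
  · rw [Finset.smul_sum, ← Finset.sum_neg_distrib]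
    refine Finset.sum_congr rfl fun v _ => ?_
    rw [Finsupp.smul_single, ← Finsupp.single_neg, smul_eq_mul, mul_neg, neg_neg, ← mul_assoc,
      faceSign_mul_self, one_mul]

/-- There are no gradient paths with more than `numTerminals` steps. -/
theorem gradientStep_pow_eq_zero : t.gradientStep G ^ (t.numTerminals + 1) = 0 := by
  have key : ∀ k : ℕ, ∀ x ∈ Finsupp.supported ℤ ℤ
      {σ : Finset V | t.terminal σ < k ∨ ∀ β, ¬ t.Matched G σ β},
      (t.gradientStep G ^ (k + 1)) x = 0 := by
    intro k
    induction k with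
    | zero =>
      intro x hx
      have := map_supported_le (P := ⊥) (f := t.gradientStep G) ?_ x hx
      · simpa using this
      · rintro σ (h | h)
        · omega
        · simpa using gradientStep_of_not_matched G t h
    | succ k ih =>
      intro x hx
      rw [pow_succ, Module.End.mul_apply]
      apply ih
      refine map_supported_le ?_ x hx
      intro σ hσ
      by_cases hm : ∀ β, ¬ t.Matched G σ β
      · rw [gradientStep_of_not_matched G t hm]
        exact Submodule.zero_mem _
      · push Not at hm
        obtain ⟨β, hβ⟩ := hm
        have hlt : t.terminal σ < k + 1 := by
          rcases hσ with h | h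
          · exact h
          · exact absurd hβ (h β)
        obtain ⟨p, hp⟩ : ∃ p, t.freeVertex σ = some p := by
          obtain ⟨_, _, _, p, hp, _⟩ := hβ
          exact ⟨p, hp⟩
        obtain ⟨rfl, hpσ⟩ := hβ.eq_insert hp
        rw [gradientStep_of_matched G t hp hβ]
        refine Submodule.sum_mem _ fun v hv => Finsupp.single_mem_supported ℤ _ ?_
        have hle := t.terminal_erase_le (insert p σ) v
        rw [← hβ.2.2.1] at hle
        rcases hle.lt_or_eq with h | h
        · exact Or.inl (by omega)
        · right
          intro ρ hρ
          have h1 := t.freeVertex_eq h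
          rw [hp] at h1
          apply (hρ.eq_insert h1).2
          simp only [Finset.mem_erase, Finset.mem_insert, true_or, and_true]
          rintro rfl
          exact hpσ hv
  ext1 σ
  apply LinearMap.ext_ring
  simp only [LinearMap.comp_apply, Finsupp.lsingle_apply, LinearMap.zero_apply]
  exact key _ _ (Finsupp.single_mem_supported ℤ _ (Or.inl (t.terminal_lt σ)))

theorem gradientPathSum_sub (x : Finset V →₀ ℤ) :
    t.gradientPathSum G (x - t.gradientStep G x) = x := by
  have h : t.gradientPathSum G * (1 - t.gradientStep G) = 1 := by
    rw [gradientPathSum, geom_sum_mul_neg, gradientStep_pow_eq_zero, sub_zero]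
  simpa using LinearMap.congr_fun h x

theorem sub_gradientPathSum (x : Finset V →₀ ℤ) :
    t.gradientPathSum G x - t.gradientStep G (t.gradientPathSum G x) = x := by
  have h : (1 - t.gradientStep G) * t.gradientPathSum G = 1 := by
    rw [gradientPathSum, mul_neg_geom_sum, gradientStep_pow_eq_zero, sub_zero]
  simpa using LinearMap.congr_fun h x

theorem gradientStep_mem (c : ℕ) :
    ∀ x ∈ faceChains G c, t.gradientStep G x ∈ faceChains G c := by
  apply map_supported_le
  rintro σ ⟨hσ, hc⟩
  by_cases hm : ∀ β, ¬ t.Matched G σ β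
  · rw [gradientStep_of_not_matched G t hm]
    exact Submodule.zero_mem _
  · push Not at hm
    obtain ⟨β, hβ⟩ := hm
    obtain ⟨p, hp⟩ : ∃ p, t.freeVertex σ = some p := by
      obtain ⟨_, _, _, p, hp, _⟩ := hβ
      exact ⟨p, hp⟩
    obtain ⟨rfl, hpσ⟩ := hβ.eq_insert hp
    rw [gradientStep_of_matched G t hp hβ]
    refine Submodule.sum_mem _ fun v hv => Finsupp.single_mem_supported ℤ _ ⟨?_, ?_⟩
    · exact hβ.2.1.mono (by exact_mod_cast Finset.erase_subset _ _)
    · rw [Finset.card_erase_of_mem (Finset.mem_insert_of_mem hv),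
        Finset.card_insert_of_notMem hpσ, hc]
      rfl

theorem gradientPathSum_mem (c : ℕ) (x : Finset V →₀ ℤ) (hx : x ∈ faceChains G c) :
    t.gradientPathSum G x ∈ faceChains G c := by
  rw [gradientPathSum, LinearMap.sum_apply]
  refine Submodule.sum_mem _ fun r _ => ?_
  clear * - hx
  induction r with
  | zero => simpa using hx
  | succ r ih =>
    rw [pow_succ', Module.End.mul_apply]
    exact gradientStep_mem G t c _ ih

theorem criticalProj_single_of_critical {σ : Finset V} (h : t.Critical G σ) :
    t.criticalProj G (Finsupp.single σ 1) = Finsupp.single σ 1 := by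
  simp [criticalProj, Finsupp.linearCombination_single, h]

theorem criticalProj_single_of_not {σ : Finset V} (h : ¬ t.Critical G σ) :
    t.criticalProj G (Finsupp.single σ 1) = 0 := by
  simp [criticalProj, Finsupp.linearCombination_single, h]

theorem criticalProj_mem (c : ℕ) :
    ∀ x ∈ faceChains G c, t.criticalProj G x ∈ t.criticalChains G c := by
  apply map_supported_le
  rintro σ ⟨hσ, hc⟩
  by_cases h : t.Critical G σ
  · rw [criticalProj_single_of_critical G t h]
    exact Finsupp.single_mem_supported ℤ _ ⟨h, hc⟩
  · rw [criticalProj_single_of_not G t h]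
    exact Submodule.zero_mem _

theorem criticalChains_le (c : ℕ) : t.criticalChains G c ≤ faceChains G c :=
  Finsupp.supported_mono fun _ h => ⟨h.1.1, h.2⟩

theorem morseBoundary_mem (c : ℕ) (x : Finset V →₀ ℤ) (hx : x ∈ t.criticalChains G (c + 1)) :
    t.morseBoundary G x ∈ t.criticalChains G c :=
  criticalProj_mem G t c _ (gradientPathSum_mem G t c _
    (simplexBoundary_mem G c _ (criticalChains_le G t (c + 1) hx)))

theorem morseBoundary_simplexBoundary (x : Finset V →₀ ℤ) :
    t.morseBoundary G (simplexBoundary V x) = 0 := by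
  have h : simplexBoundary V (simplexBoundary V x) = 0 :=
    LinearMap.congr_fun simplexBoundary_comp_self x
  simp [morseBoundary, h]

theorem morseBoundary_of_matched {α β : Finset V} (h : t.Matched G α β) :
    t.morseBoundary G (Finsupp.single β 1) = 0 := by
  obtain ⟨p, hp⟩ : ∃ p, t.freeVertex α = some p := by
    obtain ⟨_, _, _, p, hp, _⟩ := h
    exact ⟨p, hp⟩
  obtain ⟨rfl, -⟩ := h.eq_insert hp
  simp only [morseBoundary, LinearMap.comp_apply]
  rw [simplexBoundary_of_matched G t hp h, map_smul, gradientPathSum_sub, map_smul,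
    criticalProj_single_of_not G t fun hc => (hc.2 _).1 h, smul_zero]

/-- The Morse boundary does not see the difference between a face and what is left of it after
one step. -/
theorem morseBoundary_criticalProj (c : ℕ) (x : Finset V →₀ ℤ) (hx : x ∈ faceChains G c) :
    t.morseBoundary G (t.criticalProj G x) =
      t.morseBoundary G (x - t.gradientStep G x) := by
  have key := map_supported_le (s := {σ | G.IsIndepSet (σ : Set V) ∧ σ.card = c}) (P := ⊥)
    (f := t.morseBoundary G ∘ₗ (t.criticalProj G - (1 - t.gradientStep G))) ?_ x hx
  · simpa [sub_eq_zero, map_sub] using key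
  · rintro σ ⟨hσ, -⟩
    simp only [LinearMap.comp_apply, LinearMap.sub_apply, Module.End.one_apply,
      Submodule.mem_bot]
    by_cases hm : ∀ β, ¬ t.Matched G σ β
    · rw [gradientStep_of_not_matched G t hm, sub_zero]
      by_cases hc : t.Critical G σ
      · rw [criticalProj_single_of_critical G t hc, sub_self, map_zero]
      · rw [criticalProj_single_of_not G t hc, zero_sub, map_neg, neg_eq_zero]
        have : ∃ ρ, t.Matched G ρ σ := by
          by_contra hn
          push Not at hn
          exact hc ⟨hσ, fun ρ => ⟨hm ρ, hn ρ⟩⟩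
        obtain ⟨ρ, hρ⟩ := this
        exact morseBoundary_of_matched G t hρ
    · push Not at hm
      obtain ⟨β, hβ⟩ := hm
      obtain ⟨p, hp⟩ : ∃ p, t.freeVertex σ = some p := by
        obtain ⟨_, _, _, p, hp, _⟩ := hβ
        exact ⟨p, hp⟩
      obtain ⟨rfl, hpσ⟩ := hβ.eq_insert hp
      have h1 := simplexBoundary_of_matched G t hp hβ
      have h2 : Finsupp.single σ 1 - t.gradientStep G (Finsupp.single σ 1) =
          faceSign (insert p σ) p • simplexBoundary V (Finsupp.single (insert p σ) 1) := by
        rw [h1, smul_smul, faceSign_mul_self, one_smul]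
      rw [h2, criticalProj_single_of_not G t fun hc => (hc.2 _).1 hβ, zero_sub, map_neg, map_smul,
        morseBoundary_simplexBoundary, smul_zero, neg_zero]

theorem morseBoundary_morseBoundary (c : ℕ) (x : Finset V →₀ ℤ)
    (hx : x ∈ t.criticalChains G (c + 1)) : t.morseBoundary G (t.morseBoundary G x) = 0 := by
  have h := morseBoundary_criticalProj G t c _ (gradientPathSum_mem G t c _
    (simplexBoundary_mem G c _ (criticalChains_le G t (c + 1) hx)))
  rw [sub_gradientPathSum, morseBoundary_simplexBoundary] at h
  exact h

end MatchingTree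

/-! ### The chain complexes -/

/-- The augmented simplicial chain complex of the independence complex of `G` with integral
coefficients.  Degree `c` holds the chains of dimension `c - 1`, on the faces with `c` vertices. -/
noncomputable def indComplex (G : SimpleGraph V) : ChainComplex (ModuleCat ℤ) ℕ :=
  ChainComplex.of (fun c => ModuleCat.of ℤ (faceChains G c))
    (fun c => ModuleCat.ofHom ((simplexBoundary V).restrict (simplexBoundary_mem G c)))
    (fun c => by
      refine ModuleCat.hom_ext (LinearMap.ext fun x => Subtype.ext ?_)
      exact LinearMap.congr_fun simplexBoundary_comp_self x.1)

/-- The augmented Morse complex of the independence complex of `G` for a matching tree, with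
integral coefficients.  Degree `c` is free on the critical faces of dimension `c - 1`.  (If the
empty face is matched with a vertex, then this is the augmented cellular chain complex of the
resulting cell complex, with that vertex as the additional `0`-cell split off.) -/
noncomputable def MatchingTree.morseComplex (G : SimpleGraph V) (t : MatchingTree V) :
    ChainComplex (ModuleCat ℤ) ℕ :=
  ChainComplex.of (fun c => ModuleCat.of ℤ (t.criticalChains G c))
    (fun c => ModuleCat.ofHom ((t.morseBoundary G).restrict (morseBoundary_mem G t c)))
    (fun c => by
      refine ModuleCat.hom_ext (LinearMap.ext fun x => Subtype.ext ?_)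
      exact morseBoundary_morseBoundary G t (c + 1) x.1 x.2)

end Chains

/-- The reduced integral homology in dimension `d` of an augmented chain complex whose degree `c`
holds the chains of dimension `c - 1`. -/
noncomputable abbrev reducedHomology (K : ChainComplex (ModuleCat ℤ) ℕ) (d : ℕ) : ModuleCat ℤ :=
  K.homology (d + 1)

/-- The augmented cellular chain complex of `X^m_n`, the cell complex that arises from the Comb
Algorithm for the independence complex of `Δ^m_n`. -/
noncomputable def combComplex (m n : ℕ) : ChainComplex (ModuleCat ℤ) ℕ :=
  (MatchingTree.combTree m n).morseComplex (deltaGraph m n)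

/-- The number `C^d_n` of cells of dimension `d` of `X^m_n`.  The base `0`-cell, which is matched with
the empty face, does not count. -/
noncomputable def numCombCells (m n : ℕ) (d : ℤ) : ℕ :=
  {σ : Finset (DeltaVertex m n) |
    (MatchingTree.combTree m n).Critical (deltaGraph m n) σ ∧ (σ.card : ℤ) = d + 1}.ncard

/-!
The proof has an algebraic and a combinatorial half.

*Algebra.*  The gradient flow `criticalFlow = criticalProj ∘ gradientPathSum` is a surjective chain
map from the simplicial chain complex onto the Morse complex.  Its kernel is acyclic, since it is
spanned by the upper faces of the matched pairs and their boundaries.  Hence, if there are no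
critical faces in the two dimensions next to `d`, or none in dimension `d` itself, then the homology
of both complexes in dimension `d` is the free module on the critical faces of dimension `d`
(`nonempty_indComplex_homology_equiv`, `nonempty_morseComplex_homology_equiv`).

*Combinatorics.*  It remains to find the critical faces of dimension `d - 1`, `d` and `d + 1`.
The predicate `CriticalSizes` computes the multiset of the sizes of the critical faces by recursion
on the tree, in terms of the set of undecided vertices; `CriticalSizes.exists_critical` says that
this computation is correct.  A path with `3 q`, `3 q + 1` or `3 q + 2` vertices has one critical
face of size `q`, none, or one of size `q + 1`; an extended star with `m` tendrils of `3 q`,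
`3 q + 1` or `3 q + 2` vertices has none, one of size `m q + 1`, or one of size `m (q + 1)`.  Writing `F n`
for the generating function of the sizes for `Δ^m_n` and `S l` for that of the star with tendrils of
length `l`, the Comb Algorithm gives
`F n = S (n + 1) + X * S n + ∑ l ∈ [1, n - 2], X * S l * F (n - l - 2)`,
where the first two terms come from the `m` paths between `a` and `b`.  The term for `l = 1` is
`X ^ 2 * F (n - 3)`, and it carries the face of dimension `d` from `n - 3` to `n`, starting from the
faces `{a}` for `n = 0` and `{a, b}` for `n = 1`.  As `m ≥ 4`, all other terms have
degree at least `d + 3` (`exists_criticalSizes_combTreeFrom`).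
-/

/-! ### Homology of the simplicial complex and of the Morse complex -/

/-- A linear map on the chains of a complex of submodules computes the homology if it is surjective
on cycles and if the cycles in its kernel are the boundaries. -/
theorem nonempty_homology_equiv {R E : Type*} [Ring R] [AddCommGroup E] [Module R E]
    (F : ℕ → Submodule R E) (D : E →ₗ[R] E) (hD : ∀ c, ∀ x ∈ F (c + 1), D x ∈ F c)
    (hDD : ∀ c, ∀ x ∈ F (c + 2), D (D x) = 0) (K : ChainComplex (ModuleCat R) ℕ)
    (hK : K = ChainComplex.of (fun c => ModuleCat.of R (F c))
      (fun c => ModuleCat.ofHom (D.restrict (hD c)))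
      (fun c => ModuleCat.hom_ext (LinearMap.ext fun x => Subtype.ext (hDD c x.1 x.2))))
    (j : ℕ) (N : Submodule R E) (φ : E →ₗ[R] E) (hφ : ∀ x ∈ F (j + 1), φ x ∈ N)
    (hsurj : ∀ y ∈ N, ∃ x ∈ F (j + 1), D x = 0 ∧ φ x = y)
    (hker : ∀ x ∈ F (j + 1), D x = 0 → (φ x = 0 ↔ ∃ z ∈ F (j + 2), D z = x)) :
    Nonempty (K.homology (j + 1) ≃ₗ[R] N) := by
  subst hK
  set K := ChainComplex.of (fun c => ModuleCat.of R (F c))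
    (fun c => ModuleCat.ofHom (D.restrict (hD c)))
    (fun c => ModuleCat.hom_ext (LinearMap.ext fun x => Subtype.ext (hDD c x.1 x.2)))
  have hd : ∀ c, K.d (c + 1) c = ModuleCat.ofHom (D.restrict (hD c)) := fun c =>
    ChainComplex.of_d (X := fun c => ModuleCat.of R (F c))
      (d := fun c => ModuleCat.ofHom (D.restrict (hD c))) c
  let S := K.sc' (j + 2) (j + 1) j
  have hg : S.g = ModuleCat.ofHom (D.restrict (hD j)) := hd j
  have hf : S.f = ModuleCat.ofHom (D.restrict (hD (j + 1))) := hd (j + 1)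
  let φ' : S.X₂ →ₗ[R] N := φ.restrict (p := F (j + 1)) (q := N) hφ
  let ψ : LinearMap.ker S.g.hom →ₗ[R] N := φ'.comp (LinearMap.ker S.g.hom).subtype
  have hψ : Function.Surjective ψ := by
    rintro ⟨y, hy⟩
    obtain ⟨x, hx, hx0, rfl⟩ := hsurj y hy
    refine ⟨⟨(⟨x, hx⟩ : F (j + 1)), ?_⟩, rfl⟩
    rw [hg]
    exact Subtype.ext hx0
  have hr : LinearMap.range S.moduleCatToCycles = LinearMap.ker ψ := by
    ext ⟨x, hx⟩
    rw [LinearMap.mem_ker, LinearMap.mem_range]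
    obtain ⟨x, hxF⟩ : F (j + 1) := x
    rw [hg] at hx
    have hx0 : D x = 0 := congrArg Subtype.val hx
    have h := hker x hxF hx0
    constructor
    · rintro ⟨⟨z, hzF⟩, hz⟩
      have hz' := congrArg Subtype.val hz
      change S.f.hom _ = _ at hz'
      rw [hf] at hz'
      exact Subtype.ext (h.2 ⟨z, hzF, congrArg Subtype.val hz'⟩)
    · intro hx1
      obtain ⟨z, hzF, hz⟩ := h.1 (congrArg Subtype.val hx1)
      refine ⟨(⟨z, hzF⟩ : F (j + 2)), Subtype.ext ?_⟩
      change S.f.hom _ = _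
      rw [hf]
      exact Subtype.ext hz
  exact ⟨(K.homologyIsoSc' (j + 2) (j + 1) j (by simp) (by simp)).toLinearEquiv.trans
    (S.moduleCatHomologyIso.toLinearEquiv.trans
      ((Submodule.quotEquivOfEq _ _ hr).trans (ψ.quotKerEquivOfSurjective hψ)))⟩

section Morse

variable {V : Type*} [LinearOrder V] (G : SimpleGraph V) (t : MatchingTree V)

theorem simplexBoundary_simplexBoundary (x : Finset V →₀ ℤ) :
    simplexBoundary V (simplexBoundary V x) = 0 :=
  LinearMap.congr_fun simplexBoundary_comp_self x

namespace MatchingTree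

open Classical in
/-- The map that sends a face `α` to `±(α ∪ {p})` if these two faces are matched, and all other
faces to zero; the sign is the incidence number of the two faces. -/
noncomputable def gradientLift : (Finset V →₀ ℤ) →ₗ[ℤ] (Finset V →₀ ℤ) :=
  Finsupp.linearCombination ℤ fun α =>
    match t.freeVertex α with
    | none => 0
    | some p =>
      if t.Matched G α (insert p α) then
        Finsupp.single (insert p α) (faceSign (insert p α) p)
      else 0

/-- The chains on the faces that are matched with one of their facets. -/
noncomputable def upperChains : Submodule ℤ (Finset V →₀ ℤ) :=
  Finsupp.supported ℤ ℤ {β | ∃ α, t.Matched G α β}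

theorem gradientLift_of_not_matched {α : Finset V} (h : ∀ β, ¬ t.Matched G α β) :
    t.gradientLift G (Finsupp.single α 1) = 0 := by
  simp only [gradientLift, Finsupp.linearCombination_single, one_smul]
  split
  · rfl
  · rw [if_neg (h _)]

theorem gradientLift_of_matched {α : Finset V} {p : V} (hp : t.freeVertex α = some p)
    (h : t.Matched G α (insert p α)) :
    t.gradientLift G (Finsupp.single α 1) =
      Finsupp.single (insert p α) (faceSign (insert p α) p) := by
  simp only [gradientLift, Finsupp.linearCombination_single, one_smul, hp]
  rw [if_pos h]

variable {G t} in
theorem Matched.exists_eq_insert {α β : Finset V} (h : t.Matched G α β) :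
    ∃ p, t.freeVertex α = some p ∧ p ∉ α ∧ β = insert p α :=
  h.2.2.2

theorem gradientLift_mem (c : ℕ) :
    ∀ x ∈ faceChains G c, t.gradientLift G x ∈ upperChains G t ⊓ faceChains G (c + 1) := by
  apply map_supported_le
  rintro σ ⟨hσ, hc⟩
  by_cases hm : ∀ β, ¬ t.Matched G σ β
  · rw [gradientLift_of_not_matched G t hm]
    exact Submodule.zero_mem _
  · push Not at hm
    obtain ⟨β, hβ⟩ := hm
    obtain ⟨p, hp, hpσ, rfl⟩ := hβ.exists_eq_insert
    rw [gradientLift_of_matched G t hp hβ]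
    exact ⟨Finsupp.single_mem_supported ℤ _ ⟨σ, hβ⟩, Finsupp.single_mem_supported ℤ _
      ⟨hβ.2.1, by rw [Finset.card_insert_of_notMem hpσ, hc]⟩⟩

/-- The map `gradientLift ∘ gradientPathSum` is a left inverse of the boundary map on the chains
that are supported on upper faces of matched pairs. -/
theorem gradientLift_gradientPathSum_simplexBoundary (x : Finset V →₀ ℤ)
    (hx : x ∈ upperChains G t) :
    t.gradientLift G (t.gradientPathSum G (simplexBoundary V x)) = x := by
  have key := map_supported_le (s := {β | ∃ α, t.Matched G α β}) (P := ⊥)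
    (f := t.gradientLift G ∘ₗ t.gradientPathSum G ∘ₗ simplexBoundary V - 1) ?_ x hx
  · simpa [sub_eq_zero] using key
  · rintro β ⟨α, h⟩
    obtain ⟨p, hp, -, rfl⟩ := h.exists_eq_insert
    simp only [LinearMap.sub_apply, LinearMap.comp_apply, Module.End.one_apply,
      Submodule.mem_bot]
    rw [simplexBoundary_of_matched G t hp h, map_smul, gradientPathSum_sub, map_smul,
      gradientLift_of_matched G t hp h, Finsupp.smul_single, smul_eq_mul, faceSign_mul_self,
      sub_self]

/-- Up to upper faces of matched pairs and boundaries of such faces, `y - gradientStep y` is the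
critical part of `y`. -/
theorem sub_gradientStep_mem (c : ℕ) :
    ∀ y ∈ faceChains G c, y - t.gradientStep G y - t.criticalProj G y -
      simplexBoundary V (t.gradientLift G y) ∈ upperChains G t := by
  intro y hy
  refine map_supported_le (f := 1 - t.gradientStep G - t.criticalProj G -
    simplexBoundary V ∘ₗ t.gradientLift G) ?_ y hy
  rintro σ ⟨hσ, -⟩
  simp only [LinearMap.sub_apply, LinearMap.comp_apply, Module.End.one_apply]
  by_cases hm : ∀ β, ¬ t.Matched G σ β
  · rw [gradientStep_of_not_matched G t hm, gradientLift_of_not_matched G t hm, sub_zero,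
      map_zero, sub_zero]
    by_cases hc : t.Critical G σ
    · rw [criticalProj_single_of_critical G t hc, sub_self]
      exact Submodule.zero_mem _
    · rw [criticalProj_single_of_not G t hc, sub_zero]
      refine Finsupp.single_mem_supported ℤ _ ?_
      by_contra hn
      exact hc ⟨hσ, fun ρ => ⟨hm ρ, fun h => hn ⟨ρ, h⟩⟩⟩
  · push Not at hm
    obtain ⟨β, hβ⟩ := hm
    obtain ⟨p, hp, -, rfl⟩ := hβ.exists_eq_insert
    have h1 := simplexBoundary_of_matched G t hp hβ
    rw [criticalProj_single_of_not G t fun hc => (hc.2 _).1 hβ, sub_zero,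
      gradientLift_of_matched G t hp hβ, ← mul_one (faceSign _ _), ← smul_eq_mul,
      ← Finsupp.smul_single, map_smul, h1, smul_smul, faceSign_mul_self, one_smul, sub_self]
    exact Submodule.zero_mem _

/-- The gradient flow: the coefficient of a critical face `τ` in the image of a face `σ` is the signed
number of gradient paths from `σ` to `τ`. -/
noncomputable def criticalFlow : (Finset V →₀ ℤ) →ₗ[ℤ] (Finset V →₀ ℤ) :=
  t.criticalProj G ∘ₗ t.gradientPathSum G

theorem criticalFlow_mem (c : ℕ) (x : Finset V →₀ ℤ) (hx : x ∈ faceChains G c) :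
    t.criticalFlow G x ∈ t.criticalChains G c :=
  criticalProj_mem G t c _ (gradientPathSum_mem G t c x hx)

/-- The gradient flow is a chain map. -/
theorem criticalFlow_simplexBoundary (c : ℕ) (x : Finset V →₀ ℤ) (hx : x ∈ faceChains G c) :
    t.criticalFlow G (simplexBoundary V x) = t.morseBoundary G (t.criticalFlow G x) := by
  simp only [criticalFlow, LinearMap.comp_apply]
  rw [morseBoundary_criticalProj G t c _ (gradientPathSum_mem G t c x hx), sub_gradientPathSum]
  rfl

theorem criticalFlow_surjective (c : ℕ) (y : Finset V →₀ ℤ) (hy : y ∈ t.criticalChains G c) :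
    ∃ x ∈ faceChains G c, t.criticalFlow G x = y := by
  have hy' := criticalChains_le G t c hy
  refine ⟨y - t.gradientStep G y, Submodule.sub_mem _ hy' (gradientStep_mem G t c y hy'), ?_⟩
  simp only [criticalFlow, LinearMap.comp_apply, gradientPathSum_sub]
  have := map_supported_le (s := {σ | t.Critical G σ ∧ σ.card = c}) (P := ⊥)
    (f := t.criticalProj G - 1) ?_ y hy
  · simpa [sub_eq_zero] using this
  · rintro σ ⟨hσ, -⟩
    simp [criticalProj_single_of_critical G t hσ]

/-- The gradient flow vanishes on the upper faces of matched pairs. -/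
theorem criticalFlow_upper (w : Finset V →₀ ℤ) (hw : w ∈ upperChains G t) :
    t.criticalFlow G w = 0 := by
  have := map_supported_le (s := {β | ∃ α, t.Matched G α β}) (P := ⊥)
    (f := t.criticalFlow G) ?_ w hw
  · simpa using this
  · rintro β ⟨α, h⟩
    have hs := gradientStep_of_not_matched G t fun ρ hρ => hρ.not_right h
    have hP := gradientPathSum_sub G t (Finsupp.single β 1)
    rw [hs, sub_zero] at hP
    simp only [criticalFlow, LinearMap.comp_apply, Submodule.mem_bot]
    rw [hP, criticalProj_single_of_not G t fun hc => (hc.2 _).2 h]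

/-- The kernel of the gradient flow is acyclic: it is spanned by the upper faces of the matched
pairs and their boundaries. -/
theorem exists_simplexBoundary_eq (c : ℕ) (x : Finset V →₀ ℤ) (hx : x ∈ faceChains G c)
    (hd : simplexBoundary V x = 0) (hf : t.criticalFlow G x = 0) :
    ∃ z ∈ upperChains G t, z ∈ faceChains G (c + 1) ∧ simplexBoundary V z = x := by
  have hP := gradientPathSum_mem G t c x hx
  refine ⟨t.gradientLift G (t.gradientPathSum G x), (gradientLift_mem G t c _ hP).1,
    (gradientLift_mem G t c _ hP).2, ?_⟩
  have h := sub_gradientStep_mem G t c _ hP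
  rw [sub_gradientPathSum, show t.criticalProj G (t.gradientPathSum G x) = 0 from hf,
    sub_zero] at h
  have h1 := gradientLift_gradientPathSum_simplexBoundary G t _ h
  rw [map_sub, hd, simplexBoundary_simplexBoundary, sub_zero, map_zero, map_zero] at h1
  exact (sub_eq_zero.mp h1.symm).symm

/-- If there are no critical cells in the two adjacent dimensions, or none in the given dimension,
then the homology of the independence complex is free on the critical cells. -/
theorem nonempty_indComplex_homology_equiv (c : ℕ)
    (h : t.criticalChains G (c + 1) = ⊥ ∨
      t.criticalChains G c = ⊥ ∧ t.criticalChains G (c + 2) = ⊥) :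
    Nonempty ((indComplex G).homology (c + 1) ≃ₗ[ℤ] t.criticalChains G (c + 1)) := by
  refine nonempty_homology_equiv (faceChains G) (simplexBoundary V) (simplexBoundary_mem G)
    (fun _ x _ => simplexBoundary_simplexBoundary x) (indComplex G) rfl c
    (t.criticalChains G (c + 1)) (t.criticalFlow G) (criticalFlow_mem G t (c + 1))
    (fun y hy => ?_) (fun x hx hx0 => ⟨fun hf => ?_, ?_⟩)
  · rcases h with h | ⟨h, -⟩
    · rw [h, Submodule.mem_bot] at hy
      exact ⟨0, Submodule.zero_mem _, map_zero _, by rw [map_zero, hy]⟩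
    · obtain ⟨x, hx, rfl⟩ := criticalFlow_surjective G t (c + 1) y hy
      have hDx := simplexBoundary_mem G c x hx
      -- The boundary of `x` lies in the kernel of the flow; correct `x` by an element of that
      -- kernel with the same boundary.
      have h0 := criticalFlow_mem G t c _ hDx
      rw [h, Submodule.mem_bot] at h0
      obtain ⟨w, hwU, hwF, hw⟩ := exists_simplexBoundary_eq G t c _ hDx
        (simplexBoundary_simplexBoundary x) h0
      refine ⟨x - w, Submodule.sub_mem _ hx hwF, ?_, ?_⟩
      · rw [map_sub, hw, sub_self]
      · rw [map_sub, criticalFlow_upper G t w hwU, sub_zero]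
  · obtain ⟨z, -, hz⟩ := exists_simplexBoundary_eq G t (c + 1) x hx hx0 hf
    exact ⟨z, hz⟩
  · rintro ⟨z, hz, rfl⟩
    have h1 := criticalFlow_mem G t (c + 1) _ hx
    rcases h with h | ⟨-, h⟩
    · rwa [h, Submodule.mem_bot] at h1
    · have h2 := criticalFlow_mem G t (c + 2) z hz
      rw [h, Submodule.mem_bot] at h2
      rw [criticalFlow_simplexBoundary G t (c + 2) z hz, h2, map_zero]

/-- The analogue of `nonempty_indComplex_homology_equiv` for the Morse complex. -/
theorem nonempty_morseComplex_homology_equiv (c : ℕ)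
    (h : t.criticalChains G (c + 1) = ⊥ ∨
      t.criticalChains G c = ⊥ ∧ t.criticalChains G (c + 2) = ⊥) :
    Nonempty ((t.morseComplex G).homology (c + 1) ≃ₗ[ℤ] t.criticalChains G (c + 1)) := by
  have h0 : ∀ x ∈ t.criticalChains G (c + 1), t.morseBoundary G x = 0 := by
    intro x hx
    rcases h with h | ⟨h, -⟩
    · rw [h, Submodule.mem_bot] at hx
      rw [hx, map_zero]
    · have := morseBoundary_mem G t c x hx
      rwa [h, Submodule.mem_bot] at this
  have h1 : ∀ x ∈ t.criticalChains G (c + 2), t.morseBoundary G x = 0 := by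
    intro x hx
    rcases h with h | ⟨-, h⟩
    · have := morseBoundary_mem G t (c + 1) x hx
      rwa [h, Submodule.mem_bot] at this
    · rw [h, Submodule.mem_bot] at hx
      rw [hx, map_zero]
  refine nonempty_homology_equiv (t.criticalChains G) (t.morseBoundary G)
    (morseBoundary_mem G t) (fun c => morseBoundary_morseBoundary G t (c + 1))
    (t.morseComplex G) rfl c (t.criticalChains G (c + 1)) LinearMap.id
    (fun x hx => hx) (fun y hy => ⟨y, hy, h0 y hy, rfl⟩) (fun x hx _ => ⟨fun hx0 => ?_, ?_⟩)
  · exact ⟨0, Submodule.zero_mem _, (map_zero _).trans hx0.symm⟩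
  · rintro ⟨z, hz, rfl⟩
    exact h1 z hz

end MatchingTree

end Morse

/-! ### Critical faces of a matching tree by recursion -/

namespace MatchingTree

section CriticalSizes

variable {V : Type*} {G : SimpleGraph V}

variable (G) in
/-- `CriticalSizes G t U M` says that, at a node of a matching tree whose undecided vertices are
those in `U`, the subtree `t` leaves critical faces with numbers of vertices `M` (a multiset with
one entry for each critical face, in which only the vertices in `U` are counted).  It is restricted
to trees in which every split
happens at an undecided vertex, every free vertex is isolated among the undecided vertices, and
nothing is undecided at a leaf. -/
inductive CriticalSizes : MatchingTree V → Set V → Multiset ℕ → Prop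
  | leaf : CriticalSizes leaf ∅ {0}
  | free {p : V} {U : Set V} (hp : p ∈ U) (h : ∀ w ∈ U, ¬ G.Adj p w) : CriticalSizes (free p) U 0
  | split {v : V} {l r : MatchingTree V} {U : Set V} {M N : Multiset ℕ} (hv : v ∈ U)
      (hl : CriticalSizes l {w | w ∈ U ∧ w ≠ v} M)
      (hr : CriticalSizes r {w | w ∈ U ∧ w ≠ v ∧ ¬ G.Adj v w} N) :
      CriticalSizes (split v l r) U (M + N.map (· + 1))

theorem CriticalSizes.of_eq {t : MatchingTree V} {U U' : Set V} {M M' : Multiset ℕ}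
    (h : CriticalSizes G t U M) (hU : ∀ w, w ∈ U' ↔ w ∈ U) (hM : M' = M) :
    CriticalSizes G t U' M' := by
  obtain rfl : U' = U := Set.ext hU
  rwa [hM]

theorem CriticalSizes.of_sizes_eq {t : MatchingTree V} {U : Set V} {M M' : Multiset ℕ}
    (h : CriticalSizes G t U M) (hM : M' = M) : CriticalSizes G t U M' :=
  hM ▸ h

variable [LinearOrder V]

/-- Free vertices are taken among the undecided vertices. -/
theorem CriticalSizes.freeVertex_mem {t : MatchingTree V} {U : Set V} {M : Multiset ℕ}
    (h : CriticalSizes G t U M) {σ : Finset V} {p : V} (hp : t.freeVertex σ = some p) :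
    p ∈ U := by
  induction h with
  | leaf => simp [freeVertex] at hp
  | free hpU _ =>
    simp only [freeVertex, Option.some.injEq] at hp
    exact hp ▸ hpU
  | split hv _ _ ihl ihr =>
    simp only [freeVertex] at hp
    split_ifs at hp
    · exact (ihr hp).1
    · exact (ihl hp).1

theorem matched_split_iff {v : V} {l r : MatchingTree V} {α β : Finset V} :
    (split v l r).Matched G α β ↔
      v ∈ α ∧ v ∈ β ∧ r.Matched G α β ∨ v ∉ α ∧ v ∉ β ∧ l.Matched G α β := by
  have h1 := l.terminal_lt α
  have h2 := l.terminal_lt β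
  unfold Matched
  simp only [terminal, freeVertex]
  by_cases hα : v ∈ α <;> by_cases hβ : v ∈ β <;> simp only [hα, hβ, if_true, if_false,
    not_true_eq_false, not_false_eq_true, true_and, false_and, or_false, false_or, iff_false,
    Nat.add_left_cancel_iff]
  all_goals
    rintro ⟨-, -, h, -⟩
    omega

/-- Below a split at `v`, the criticality of a face only depends on the branch that it belongs to,
provided that `v` is not used as a free vertex in that branch. -/
theorem critical_split_iff_right {v : V} {l r : MatchingTree V} {σ : Finset V} (hv : v ∈ σ)
    (hf : r.freeVertex σ ≠ some v) : (split v l r).Critical G σ ↔ r.Critical G σ := by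
  refine and_congr_right fun _ => forall_congr' fun ρ => and_congr (not_congr ?_) (not_congr ?_)
  · rw [matched_split_iff]
    refine ⟨fun h => ?_, fun h => Or.inl ⟨hv, ?_, h⟩⟩
    · rcases h with h | h
      · exact h.2.2
      · exact absurd hv h.1
    · obtain ⟨p, -, -, rfl⟩ := h.exists_eq_insert
      exact Finset.mem_insert_of_mem hv
  · rw [matched_split_iff]
    refine ⟨fun h => ?_, fun h => Or.inl ⟨?_, hv, h⟩⟩
    · rcases h with h | h
      · exact h.2.2
      · exact absurd hv h.2.1
    · obtain ⟨p, hp, -, rfl⟩ := h.exists_eq_insert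
      rw [r.freeVertex_eq h.2.2.1] at hp
      refine (Finset.mem_insert.mp hv).resolve_left ?_
      rintro rfl
      exact hf hp

theorem critical_split_iff_left {v : V} {l r : MatchingTree V} {σ : Finset V} (hv : v ∉ σ)
    (hf : l.freeVertex σ ≠ some v) : (split v l r).Critical G σ ↔ l.Critical G σ := by
  refine and_congr_right fun _ => forall_congr' fun ρ => and_congr (not_congr ?_) (not_congr ?_)
  · rw [matched_split_iff]
    refine ⟨fun h => ?_, fun h => Or.inr ⟨hv, ?_, h⟩⟩
    · rcases h with h | h
      · exact absurd h.1 hv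
      · exact h.2.2
    · obtain ⟨p, hp, -, rfl⟩ := h.exists_eq_insert
      rw [Finset.mem_insert, not_or]
      refine ⟨?_, hv⟩
      rintro rfl
      exact hf hp
  · rw [matched_split_iff]
    refine ⟨fun h => ?_, fun h => Or.inr ⟨?_, hv, h⟩⟩
    · rcases h with h | h
      · exact absurd h.2.1 hv
      · exact h.2.2
    · obtain ⟨p, -, -, rfl⟩ := h.exists_eq_insert
      exact fun h1 => hv (Finset.mem_insert_of_mem h1)

theorem not_critical_free {p : V} {σ : Finset V} (h : ∀ w ∈ σ, ¬ G.Adj p w) :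
    ¬ (free p).Critical G σ := by
  rintro ⟨hσ, hc⟩
  by_cases hp : p ∈ σ
  · refine (hc (σ.erase p)).2 ⟨hσ.mono (by simp), hσ, rfl, p, rfl, by simp, ?_⟩
    rw [Finset.insert_erase hp]
  · refine (hc (insert p σ)).1 ⟨hσ, ?_, rfl, p, rfl, hp, rfl⟩
    rw [Finset.coe_insert, SimpleGraph.isIndepSet_iff, Set.pairwise_insert]
    refine ⟨hσ, fun b hb _ => ⟨h b hb, fun h' => h b hb h'.symm⟩⟩

theorem critical_leaf_iff {σ : Finset V} :
    (leaf : MatchingTree V).Critical G σ ↔ G.IsIndepSet (σ : Set V) := by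
  refine and_iff_left_of_imp fun _ ρ => ⟨?_, ?_⟩ <;>
  · rintro ⟨-, -, -, p, hp, -⟩
    simp [freeVertex] at hp

/-- The critical faces at a node where the set `A` is included and the vertices in `U` are
undecided correspond to the numbers of vertices in `CriticalSizes`. -/
theorem CriticalSizes.exists_critical {t : MatchingTree V} {U : Set V} {M : Multiset ℕ}
    (h : CriticalSizes G t U M) (A : Finset V) (hA : G.IsIndepSet (A : Set V))
    (hAU : ∀ a ∈ A, a ∉ U) (hadj : ∀ a ∈ A, ∀ w ∈ U, ¬ G.Adj a w) :
    ∃ K : Finset (Finset V), K.val.map Finset.card = M ∧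
      ∀ τ, τ ∈ K ↔ (τ : Set V) ⊆ U ∧ t.Critical G (A ∪ τ) := by
  induction h generalizing A with
  | leaf =>
    refine ⟨{∅}, by simp, fun τ => ?_⟩
    simp only [Finset.mem_singleton, Set.subset_empty_iff, Finset.coe_eq_empty, critical_leaf_iff]
    refine ⟨?_, fun h => h.1⟩
    rintro rfl
    simpa using hA
  | @free p U hp hf =>
    refine ⟨∅, by simp, fun τ => ?_⟩
    simp only [Finset.notMem_empty, false_iff, not_and]
    refine fun hτ => not_critical_free fun w hw hpw => ?_
    rcases Finset.mem_union.mp hw with hw | hw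
    · exact hadj w hw p hp hpw.symm
    · exact hf w (hτ hw) hpw
  | @split v l r U M N hv hl hr ihl ihr =>
    have hvA : v ∉ A := fun h => hAU v h hv
    obtain ⟨Kl, hKl, hl'⟩ := ihl A hA (fun a ha h => hAU a ha h.1)
      (fun a ha w hw => hadj a ha w hw.1)
    obtain ⟨Kr, hKr, hr'⟩ := ihr (insert v A)
      (by
        rw [Finset.coe_insert, SimpleGraph.isIndepSet_iff, Set.pairwise_insert]
        exact ⟨hA, fun b hb _ => ⟨fun h' => hadj b hb v hv h'.symm, hadj b hb v hv⟩⟩)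
      (by
        intro a ha h
        rcases Finset.mem_insert.mp ha with rfl | ha
        · exact h.2.1 rfl
        · exact hAU a ha h.1)
      (by
        intro a ha w hw
        rcases Finset.mem_insert.mp ha with rfl | ha
        · exact hw.2.2
        · exact hadj a ha w hw.1)
    have hvl : ∀ τ ∈ Kl, v ∉ τ := fun τ hτ h => (((hl' τ).1 hτ).1 h).2 rfl
    have hvr : ∀ τ ∈ Kr, v ∉ τ := fun τ hτ h => (((hr' τ).1 hτ).1 h).2.1 rfl
    have hinj : Set.InjOn (insert v) (Kr : Set (Finset V)) := by
      intro τ hτ τ' hτ' h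
      rw [← Finset.erase_insert (hvr τ hτ), ← Finset.erase_insert (hvr τ' hτ'), h]
    have hdisj : Disjoint Kl (Kr.image (insert v)) := by
      rw [Finset.disjoint_left]
      intro τ hτ h
      obtain ⟨τ', -, rfl⟩ := Finset.mem_image.mp h
      exact hvl _ hτ (Finset.mem_insert_self _ _)
    -- Criticality with respect to a branch also refers to faces outside of the node; the two
    -- `critical_split_iff` lemmas apply since `v` is decided, hence not a free vertex, below.
    refine ⟨Kl.disjUnion (Kr.image (insert v)) hdisj, ?_, fun τ => ?_⟩
    · rw [Finset.disjUnion_val, Multiset.map_add, hKl, Finset.image_val_of_injOn hinj,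
        Multiset.map_map, ← hKr, Multiset.map_map]
      congr 1
      refine Multiset.map_congr rfl fun τ hτ => ?_
      simp [Finset.card_insert_of_notMem (hvr τ hτ)]
    · rw [Finset.mem_disjUnion, Finset.mem_image]
      by_cases hvτ : v ∈ τ
      · have hfv : r.freeVertex (A ∪ τ) ≠ some v := fun h => (hr.freeVertex_mem h).2.1 rfl
        rw [critical_split_iff_right (Finset.mem_union_right A hvτ) hfv]
        have hAτ : ∀ ρ : Finset V, insert v A ∪ ρ = A ∪ insert v ρ := fun ρ => by
          rw [Finset.insert_union, Finset.union_insert]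
        constructor
        · rintro (h | ⟨ρ, hρ, rfl⟩)
          · exact absurd hvτ (hvl τ h)
          · obtain ⟨h1, h2⟩ := (hr' ρ).1 hρ
            rw [hAτ] at h2
            refine ⟨?_, h2⟩
            rw [Finset.coe_insert, Set.insert_subset_iff]
            exact ⟨hv, fun w hw => (h1 hw).1⟩
        · rintro ⟨h1, h2⟩
          refine Or.inr ⟨τ.erase v, (hr' _).2 ⟨fun w hw => ?_, ?_⟩, Finset.insert_erase hvτ⟩
          · obtain ⟨hwv, hwτ⟩ := Finset.mem_erase.mp (Finset.mem_coe.mp hw)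
            exact ⟨h1 hwτ, hwv, h2.1 (Finset.mem_coe.2 (Finset.mem_union_right A hvτ))
              (Finset.mem_coe.2 (Finset.mem_union_right A hwτ)) hwv.symm⟩
          · rwa [hAτ, Finset.insert_erase hvτ]
      · have hfv : l.freeVertex (A ∪ τ) ≠ some v := fun h => (hl.freeVertex_mem h).2 rfl
        have hvAτ : v ∉ A ∪ τ := by simp [hvA, hvτ]
        rw [critical_split_iff_left hvAτ hfv]
        constructor
        · rintro (h | ⟨ρ, hρ, rfl⟩)
          · obtain ⟨h1, h2⟩ := (hl' τ).1 h
            exact ⟨fun w hw => (h1 hw).1, h2⟩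
          · exact absurd (Finset.mem_insert_self _ _) hvτ
        · rintro ⟨h1, h2⟩
          refine Or.inl ((hl' τ).2 ⟨fun w hw => ⟨h1 hw, ?_⟩, h2⟩)
          rintro rfl
          exact hvτ hw

end CriticalSizes

end MatchingTree

/-! ### Critical faces of paths and extended stars -/

namespace MatchingTree

section PathsAndStars

variable {V : Type*} {G : SimpleGraph V}

variable (G) in
/-- The list of vertices is an induced path of `G`: its vertices are distinct, and precisely the
consecutive ones are adjacent. -/
def IsInducedPath : List V → Prop
  | [] => True
  | x :: l => (∀ y ∈ l, x ≠ y ∧ (G.Adj x y ↔ l.head? = some y)) ∧ IsInducedPath l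

theorem IsInducedPath.tail {l : List V} (h : IsInducedPath G l) : IsInducedPath G l.tail := by
  cases l with
  | nil => exact h
  | cons x l => exact h.2

theorem IsInducedPath.mem_tail_iff {l : List V} (h : IsInducedPath G l) (x : V) :
    x ∈ l.tail ↔ x ∈ l ∧ l.head? ≠ some x := by
  cases l with
  | nil => simp
  | cons y l =>
    simp only [List.tail_cons, List.mem_cons, List.head?_cons, ne_eq, Option.some.injEq]
    constructor
    · intro hx
      exact ⟨Or.inr hx, (h.1 x hx).1⟩
    · rintro ⟨rfl | hx, hne⟩
      · exact absurd rfl hne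
      · exact hx

/-- A path with `3 q` or `3 q + 2` vertices has one critical face, with `q` or `q + 1` vertices, and
a path with `3 q + 1` vertices has none.  If the number of vertices is divisible by three, then the
last vertex of the path is excluded in the critical face, so that its neighbours outside the path
do not matter. -/
theorem CriticalSizes.pathTree {t : MatchingTree V} {W : Set V} {N : Multiset ℕ}
    (ht : CriticalSizes G t W N) :
    ∀ l : List V, IsInducedPath G l → (∀ x ∈ l, x ∉ W) →
      (∀ x ∈ l, (l.length % 3 = 0 → l.getLast? ≠ some x) → ∀ w ∈ W, ¬ G.Adj x w) →
      CriticalSizes G (pathTree l t) {w | w ∈ l ∨ w ∈ W}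
        (if l.length % 3 = 1 then 0 else N.map (· + (l.length + 1) / 3))
  | [], _, _, _ => ht.of_eq (by simp) (by simp)
  | [x], _, _, hadj => by
    simp only [MatchingTree.pathTree]
    refine .of_sizes_eq (.free (Or.inl (by simp)) ?_) (by simp)
    rintro w (hw | hw)
    · simp only [List.mem_singleton] at hw
      subst hw
      exact G.irrefl
    · exact hadj x (by simp) (by simp) w hw
  | [x, y], hl, hW, hadj => by
    simp only [MatchingTree.pathTree, pair]
    simp only [IsInducedPath, List.mem_singleton, forall_eq, List.head?_cons] at hl
    have hxy : G.Adj x y := by simpa using hl.1.2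
    have hx := hadj x (by simp) (by simp)
    have hy := hadj y (by simp) (by simp)
    refine .of_sizes_eq (.split (M := 0) (N := N) (Or.inl (by simp))
      (.free ⟨Or.inl (by simp), hl.1.1⟩ ?_) (ht.of_eq ?_ rfl)) (by simp)
    · rintro w ⟨hw | hw, hwy⟩
      · simp only [List.mem_cons, hwy, List.not_mem_nil, or_false] at hw
        subst hw
        exact G.irrefl
      · exact hx w hw
    · intro w
      constructor
      · rintro ⟨hw | hw, hwy, hyw⟩
        · simp only [List.mem_cons, hwy, List.not_mem_nil, or_false] at hw
          subst hw
          exact absurd hxy.symm hyw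
        · exact hw
      · intro hw
        refine ⟨Or.inr hw, ?_, hy w hw⟩
        rintro rfl
        exact hW w (by simp) hw
  | x :: y :: z :: l, hl, hW, hadj => by
    obtain ⟨hx, hy, hz, hl⟩ := hl
    have hlast : ∀ v ∈ l, l.getLast? ≠ some v → (x :: y :: z :: l).getLast? ≠ some v := by
      intro v hv h
      cases l with
      | nil => simp at hv
      | cons u l => simpa [List.getLast?_cons_cons] using h
    have hmod : (x :: y :: z :: l).length % 3 = l.length % 3 := by
      simp only [List.length_cons]
      omega
    have hnd : x ≠ y ∧ x ≠ z ∧ y ≠ z := ⟨(hx y (by simp)).1, (hx z (by simp)).1, (hy z (by simp)).1⟩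
    have hxy : G.Adj x y := ((hx y (by simp)).2).2 rfl
    have hyz : G.Adj y z := ((hy z (by simp)).2).2 rfl
    have hxz : ¬ G.Adj x z := fun h => hnd.2.2 (by simpa using ((hx z (by simp)).2).1 h)
    have hne : ∀ v, v = x ∨ v = y → (x :: y :: z :: l).getLast? ≠ some v := by
      rintro v hv
      have h1 : v ∉ z :: l := by
        rcases hv with rfl | rfl
        · exact fun h => (hx v (List.mem_cons_of_mem _ h)).1 rfl
        · exact fun h => (hy v h).1 rfl
      rw [List.getLast?_cons_cons, List.getLast?_cons_cons]
      exact fun h => h1 (List.mem_of_getLast? h)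
    have hxW := hadj x (by simp) (fun _ => hne x (Or.inl rfl))
    have hyW := hadj y (by simp) (fun _ => hne y (Or.inr rfl))
    have ih := CriticalSizes.pathTree ht l hl (fun v hv => hW v (by simp [hv]))
      (fun v hv h => hadj v (by simp [hv]) fun h' => hlast v hv (h (by rwa [hmod] at h')))
    simp only [MatchingTree.pathTree, pair]
    refine .of_sizes_eq (.split (M := 0) (Or.inl (by simp)) (.free ⟨Or.inl (by simp), hnd.1⟩ ?_)
      (ih.of_eq ?_ rfl)) ?_
    · rintro w ⟨hw | hw, hwy⟩ hxw
      · simp only [List.mem_cons, hwy, false_or] at hw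
        rcases hw with rfl | rfl | hw
        · exact G.irrefl hxw
        · exact hxz hxw
        · exact hwy (by simpa using ((hx w (by simp [hw])).2.1 hxw).symm)
      · exact hxW w hw hxw
    · intro w
      constructor
      · rintro ⟨hw | hw, hwy, hyw⟩
        · simp only [List.mem_cons, hwy, false_or] at hw
          rcases hw with rfl | rfl | hw
          · exact absurd hxy.symm hyw
          · exact absurd hyz hyw
          · exact Or.inl hw
        · exact Or.inr hw
      · rintro (hw | hw)
        · refine ⟨Or.inl (by simp [hw]), (hy w (by simp [hw])).1.symm, fun h => ?_⟩
          have h1 := (hy w (by simp [hw])).2.1 h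
          simp only [List.head?_cons, Option.some.injEq] at h1
          exact (hz w hw).1 h1
        · refine ⟨Or.inr hw, ?_, hyW w hw⟩
          rintro rfl
          exact hW w (by simp) hw
    · rw [hmod]
      split_ifs
      · simp
      · rw [Multiset.map_map, zero_add]
        refine Multiset.map_congr rfl fun k _ => ?_
        simp only [List.length_cons, Function.comp_apply]
        omega

/-- Two lists of vertices are disjoint and without edges between them. -/
def Apart (G : SimpleGraph V) (l l' : List V) : Prop :=
  ∀ x ∈ l, ∀ y ∈ l', x ≠ y ∧ ¬ G.Adj x y

theorem CriticalSizes.pathsTree {t : MatchingTree V} {W : Set V} {N : Multiset ℕ}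
    (ht : CriticalSizes G t W N) (len : ℕ) (ls : List (List V)) (hlen : ∀ l ∈ ls, l.length = len)
    (hpath : ∀ l ∈ ls, IsInducedPath G l) (hapart : ls.Pairwise (Apart G))
    (hW : ∀ l ∈ ls, ∀ x ∈ l, x ∉ W)
    (hadj : ∀ l ∈ ls, ∀ x ∈ l, (len % 3 = 0 → l.getLast? ≠ some x) → ∀ w ∈ W, ¬ G.Adj x w) :
    CriticalSizes G (pathsTree ls t) {w | (∃ l ∈ ls, w ∈ l) ∨ w ∈ W}
      (if len % 3 = 1 ∧ ls ≠ [] then 0 else N.map (· + ls.length * ((len + 1) / 3))) := by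
  induction ls with
  | nil => exact ht.of_eq (by simp) (by simp)
  | cons l ls ih =>
    simp only [List.mem_cons, forall_eq_or_imp] at hlen hpath hW hadj
    rw [List.pairwise_cons] at hapart
    have h := ih hlen.2 hpath.2 hapart.2 hW.2 hadj.2
    refine (CriticalSizes.pathTree h l hpath.1 ?_ ?_).of_eq ?_ ?_
    · rintro x hx (⟨l', hl', hx'⟩ | hx')
      · exact (hapart.1 l' hl' x hx x hx').1 rfl
      · exact hW.1 x hx hx'
    · rintro x hx hlast w (⟨l', hl', hw⟩ | hw)
      · exact (hapart.1 l' hl' x hx w hw).2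
      · exact hadj.1 x hx (by rwa [hlen.1] at hlast) w hw
    · intro w
      simp [or_assoc]
    · rw [hlen.1]
      by_cases hm : len % 3 = 1
      · simp [hm]
      · simp only [hm, false_and, if_false, Multiset.map_map, List.length_cons]
        refine Multiset.map_congr rfl fun k _ => ?_
        simp only [Function.comp_apply]
        ring

/-- The numbers of vertices of the critical faces of an extended star with `m` tendrils of length
`len`, combined with critical faces of sizes `N` of the rest of the graph. -/
def starSizes (m len : ℕ) (N : Multiset ℕ) : Multiset ℕ :=
  if len % 3 = 0 then 0
  else N.map (· + if len % 3 = 1 then m * (len / 3) + 1 else m * ((len + 1) / 3))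

theorem CriticalSizes.starTree {t : MatchingTree V} {W : Set V} {N : Multiset ℕ}
    (ht : CriticalSizes G t W N) (c : V) (len : ℕ) (ls : List (List V)) (hls : ls ≠ [])
    (hlen : ∀ l ∈ ls, l.length = len)
    (hpath : ∀ l ∈ ls, IsInducedPath G l ∧ IsInducedPath G l.reverse)
    (hapart : ls.Pairwise (Apart G))
    (hW : ∀ l ∈ ls, ∀ x ∈ l, x ∉ W ∧ ∀ w ∈ W, ¬ G.Adj x w)
    (hcW : c ∉ W ∧ ∀ w ∈ W, ¬ G.Adj c w)
    (hc : ∀ l ∈ ls, ∀ x ∈ l, x ≠ c ∧ (G.Adj c x ↔ l.head? = some x)) :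
    CriticalSizes G (starTree c ls len t) {w | w = c ∨ (∃ l ∈ ls, w ∈ l) ∨ w ∈ W}
      (starSizes ls.length len N) := by
  unfold MatchingTree.starTree starSizes
  by_cases h0 : len % 3 = 0
  · rw [if_pos h0, if_pos h0]
    have hf : CriticalSizes G (.free c) {w | w = c ∨ w ∈ W} 0 := by
      refine .free (Or.inl rfl) ?_
      rintro w (rfl | hw)
      · exact G.irrefl
      · exact hcW.2 w hw
    refine (hf.pathsTree len (ls.map List.reverse) ?_ ?_ ?_ ?_ ?_).of_eq ?_ (by simp)
    · simpa only [List.forall_mem_map, List.length_reverse] using hlen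
    · simpa only [List.forall_mem_map] using fun l hl => (hpath l hl).2
    · rw [List.pairwise_map]
      refine hapart.imp fun {l l'} h x hx y hy => ?_
      exact h x (List.mem_reverse.1 hx) y (List.mem_reverse.1 hy)
    · intro l hl x hx
      obtain ⟨l', hl', rfl⟩ := List.mem_map.1 hl
      rw [List.mem_reverse] at hx
      rintro (h | h)
      · exact (hc l' hl' x hx).1 h
      · exact (hW l' hl' x hx).1 h
    · intro l hl x hx hlast w hw
      obtain ⟨l', hl', rfl⟩ := List.mem_map.1 hl
      rw [List.mem_reverse] at hx
      rw [List.getLast?_reverse] at hlast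
      rcases hw with rfl | hw
      · exact fun h => hlast h0 ((hc l' hl' x hx).2.1 h.symm)
      · exact (hW l' hl' x hx).2 w hw
    · intro w
      simp only [Set.mem_ofPred_eq, List.mem_map, exists_exists_and_eq_and, List.mem_reverse]
      exact or_left_comm
  · rw [if_neg h0, if_neg h0]
    have hl := ht.pathsTree len ls hlen (fun l hl => (hpath l hl).1) hapart
      (fun l hl x hx => (hW l hl x hx).1) (fun l hl x hx _ => (hW l hl x hx).2)
    have hr := ht.pathsTree (len - 1) (ls.map List.tail)
      (by
        simp only [List.mem_map, forall_exists_index, and_imp, forall_apply_eq_imp_iff₂,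
          List.length_tail]
        exact fun l hl => by rw [hlen l hl])
      (by simpa using fun l hl => (hpath l hl).1.tail)
      (by
        rw [List.pairwise_map]
        exact hapart.imp fun {l l'} h x hx y hy =>
          h x (List.mem_of_mem_tail hx) y (List.mem_of_mem_tail hy))
      (by
        intro l hl x hx
        obtain ⟨l', hl', rfl⟩ := List.mem_map.1 hl
        exact (hW l' hl' x (List.mem_of_mem_tail hx)).1)
      (by
        intro l hl x hx _
        obtain ⟨l', hl', rfl⟩ := List.mem_map.1 hl
        exact (hW l' hl' x (List.mem_of_mem_tail hx)).2)
    refine .of_sizes_eq (.split (Or.inl rfl) (hl.of_eq (fun w => ?_) rfl)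
      (hr.of_eq (fun w => ?_) rfl)) ?_
    · constructor
      · rintro ⟨h | h, hne⟩
        · exact absurd h hne
        · exact h
      · rintro (⟨l, hl, hw⟩ | hw)
        · exact ⟨Or.inr (Or.inl ⟨l, hl, hw⟩), (hc l hl w hw).1⟩
        · refine ⟨Or.inr (Or.inr hw), ?_⟩
          rintro rfl
          exact hcW.1 hw
    · constructor
      · rintro ⟨h | ⟨l, hl, hw⟩ | hw, hne, hadj⟩
        · exact absurd h hne
        · refine Or.inl ⟨l.tail, List.mem_map_of_mem hl, ?_⟩
          rw [(hpath l hl).1.mem_tail_iff]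
          exact ⟨hw, fun h => hadj ((hc l hl w hw).2.2 h)⟩
        · exact Or.inr hw
      · rintro (⟨l, hl, hw⟩ | hw)
        · obtain ⟨l', hl', rfl⟩ := List.mem_map.1 hl
          rw [(hpath l' hl').1.mem_tail_iff] at hw
          exact ⟨Or.inr (Or.inl ⟨l', hl', hw.1⟩), (hc l' hl' w hw.1).1,
            fun h => hw.2 ((hc l' hl' w hw.1).2.1 h)⟩
        · refine ⟨Or.inr (Or.inr hw), ?_, hcW.2 w hw⟩
          rintro rfl
          exact hcW.1 hw
    · have h12 : len % 3 = 1 ∨ len % 3 = 2 := by omega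
      rcases h12 with h1 | h2
      · have e : (len - 1 + 1) / 3 = len / 3 := by omega
        have e' : (len - 1) % 3 ≠ 1 := by omega
        simp only [h1, hls, e, e', ne_eq, not_false_eq_true, and_self, if_true, false_and, if_false,
          List.length_map, zero_add, Multiset.map_map]
        exact Multiset.map_congr rfl fun k _ => by simp only [Function.comp_apply]; ring
      · have e' : (len - 1) % 3 = 1 := by omega
        simp [h2, hls, e']

end PathsAndStars

end MatchingTree

/-! ### The Comb Algorithm on `Δ^m_n` -/

section DeltaGraph

variable {m n : ℕ}

theorem deltaGraph_adj_spine_spine {k k' : Fin (n + 2)} :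
    ¬ (deltaGraph m n).Adj (.spine k) (.spine k') := by
  simp [deltaGraph, deltaRel]

theorem deltaGraph_adj_spine_path {k : Fin (n + 2)} {j : Fin m} {i : Fin (n + 1)} :
    (deltaGraph m n).Adj (.spine k) (.path j i) ↔ (k : ℕ) = i ∨ (k : ℕ) = i + 1 := by
  simp [deltaGraph, deltaRel, Fin.ext_iff]

theorem deltaGraph_adj_path_spine {k : Fin (n + 2)} {j : Fin m} {i : Fin (n + 1)} :
    (deltaGraph m n).Adj (.path j i) (.spine k) ↔ (k : ℕ) = i ∨ (k : ℕ) = i + 1 := by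
  rw [SimpleGraph.adj_comm, deltaGraph_adj_spine_path]

theorem deltaGraph_adj_path_path {j j' : Fin m} {i i' : Fin (n + 1)} :
    (deltaGraph m n).Adj (.path j i) (.path j' i') ↔
      j = j' ∧ ((i' : ℕ) = i + 1 ∨ (i : ℕ) = i' + 1) := by
  simp only [deltaGraph, deltaRel, SimpleGraph.fromRel_adj, ne_eq, DeltaVertex.path.injEq, not_and,
    Fin.ext_iff]
  grind

end DeltaGraph

namespace MatchingTree

theorem isInducedPath_map_range' {V : Type*} {G : SimpleGraph V} (f : ℕ → V) (len : ℕ) :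
    ∀ s, (∀ a b, s ≤ a → a < b → b < s + len → f a ≠ f b ∧ (G.Adj (f a) (f b) ↔ b = a + 1)) →
      IsInducedPath G ((List.range' s len).map f) := by
  induction len with
  | zero => exact fun _ _ => trivial
  | succ len ih =>
    intro s h
    rw [List.range'_succ, List.map_cons]
    refine ⟨fun y hy => ?_, ih (s + 1) fun a b ha hab hb => h a b (by omega) hab (by omega)⟩
    obtain ⟨b, hb, rfl⟩ := List.mem_map.1 hy
    rw [List.mem_range'_1] at hb
    obtain ⟨h1, h2⟩ := h s b le_rfl (by omega) (by omega)
    refine ⟨h1, h2.trans ?_⟩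
    obtain ⟨len, rfl⟩ : ∃ k, len = k + 1 := ⟨len - 1, by omega⟩
    rw [List.range'_succ, List.map_cons, List.head?_cons, Option.some.injEq]
    refine ⟨fun h => by rw [h], fun hf => ?_⟩
    by_contra hne
    exact (h (s + 1) b (by omega) (by omega) (by omega)).1 hf

section Segments

variable {m n : ℕ}

/-- The list of the vertices `path j i` with `lo ≤ i < hi`. -/
def pathSegment (n lo hi : ℕ) (j : Fin m) : List (DeltaVertex m n) :=
  (List.range' lo (hi - lo)).map fun i => .path j (Fin.ofNat (n + 1) i)

theorem filter_finRange_eq (n lo hi : ℕ) (h : hi ≤ n + 1) :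
    ((List.finRange (n + 1)).filter fun i : Fin (n + 1) => decide (lo ≤ (i : ℕ) ∧ (i : ℕ) < hi)) =
      (List.range' lo (hi - lo)).map (Fin.ofNat (n + 1)) := by
  have hval : Function.Injective (List.map (Fin.val : Fin (n + 1) → ℕ)) :=
    List.map_injective_iff.2 Fin.val_injective
  apply hval
  have h1 : (((List.finRange (n + 1)).filter fun i : Fin (n + 1) =>
      decide (lo ≤ (i : ℕ) ∧ (i : ℕ) < hi))).map Fin.val =
      (List.range (n + 1)).filter fun i => decide (lo ≤ i ∧ i < hi) := by
    rw [← List.map_coe_finRange_eq_range, List.filter_map]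
    rfl
  have h2 : ((List.range' lo (hi - lo)).map (Fin.ofNat (n + 1))).map Fin.val =
      List.range' lo (hi - lo) := by
    rw [List.map_map]
    conv_rhs => rw [← List.map_id (List.range' lo (hi - lo))]
    refine List.map_congr_left fun i hi' => ?_
    rw [List.mem_range'_1] at hi'
    simp only [Function.comp_apply, Fin.val_ofNat, id_eq]
    exact Nat.mod_eq_of_lt (by omega)
  rw [h1, h2]
  refine List.Perm.eq_of_pairwise (le := (· < ·)) (fun a b _ _ h1 h2 => absurd h1 (by omega))
    (List.pairwise_lt_range.filter _) List.pairwise_lt_range' ?_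
  refine (List.perm_ext_iff_of_nodup (List.nodup_range.filter _) List.nodup_range').2 fun i => ?_
  simp only [List.mem_filter, List.mem_range, decide_eq_true_eq, List.mem_range'_1]
  omega

theorem pathSegments_eq (lo hi : ℕ) (h : hi ≤ n + 1) :
    pathSegments m n lo hi = (List.finRange m).map (pathSegment n lo hi) := by
  unfold pathSegments pathSegment
  simp only [filter_finRange_eq n lo hi h, List.map_map]
  rfl

theorem length_pathSegment (lo hi : ℕ) (j : Fin m) :
    (pathSegment n lo hi j).length = hi - lo := by
  simp [pathSegment]

theorem mem_pathSegment {lo hi : ℕ} (h : hi ≤ n + 1) {j : Fin m} {v : DeltaVertex m n} :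
    v ∈ pathSegment n lo hi j ↔ ∃ i : Fin (n + 1), v = .path j i ∧ lo ≤ i ∧ (i : ℕ) < hi := by
  simp only [pathSegment, List.mem_map, List.mem_range'_1]
  constructor
  · rintro ⟨i, hi', rfl⟩
    refine ⟨Fin.ofNat (n + 1) i, rfl, ?_⟩
    rw [Fin.val_ofNat, Nat.mod_eq_of_lt (by omega)]
    omega
  · rintro ⟨i, rfl, h1, h2⟩
    exact ⟨i, by omega, by simp⟩

theorem head?_pathSegment {lo hi : ℕ} {j : Fin m} {i : Fin (n + 1)}
    (hi' : (i : ℕ) < hi) (hlo : lo ≤ i) :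
    (pathSegment n lo hi j).head? = some (.path j i) ↔ (i : ℕ) = lo := by
  obtain ⟨k, hk⟩ : ∃ k, hi - lo = k + 1 := ⟨hi - lo - 1, by omega⟩
  rw [pathSegment, hk, List.range'_succ, List.map_cons, List.head?_cons, Option.some.injEq,
    DeltaVertex.path.injEq, and_iff_right rfl, Fin.ext_iff, Fin.val_ofNat,
    Nat.mod_eq_of_lt (by omega)]
  exact eq_comm

theorem dropLast_pathSegment {lo hi : ℕ} (j : Fin m) :
    (pathSegment n lo hi j).dropLast = pathSegment n lo (hi - 1) j := by
  rw [pathSegment, pathSegment, ← List.map_dropLast]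
  rcases Nat.lt_or_ge lo hi with h | h
  · obtain ⟨k, hk⟩ : ∃ k, hi - lo = k + 1 := ⟨hi - lo - 1, by omega⟩
    rw [hk, List.range'_concat, List.dropLast_concat, show hi - 1 - lo = k by omega]
  · rw [show hi - lo = 0 by omega, show hi - 1 - lo = 0 by omega]
    rfl

theorem isInducedPath_pathSegment {lo hi : ℕ} (h : hi ≤ n + 1) (j : Fin m) :
    IsInducedPath (deltaGraph m n) (pathSegment n lo hi j) := by
  refine isInducedPath_map_range' _ _ _ fun a b _ hab hb => ?_
  have ha' : a % (n + 1) = a := Nat.mod_eq_of_lt (by omega)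
  have hb' : b % (n + 1) = b := Nat.mod_eq_of_lt (by omega)
  simp only [deltaGraph_adj_path_path, ne_eq, DeltaVertex.path.injEq,
    true_and, Fin.ext_iff, Fin.val_ofNat, ha', hb']
  omega

theorem isInducedPath_reverse_pathSegment {lo hi : ℕ} (h : hi ≤ n + 1) (j : Fin m) :
    IsInducedPath (deltaGraph m n) (pathSegment n lo hi j).reverse := by
  rw [pathSegment, ← List.map_reverse, List.reverse_range', List.map_map, List.range_eq_range']
  refine isInducedPath_map_range' _ _ _ fun a b _ hab hb => ?_
  have ha' : (lo + (hi - lo) - 1 - a) % (n + 1) = lo + (hi - lo) - 1 - a :=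
    Nat.mod_eq_of_lt (by omega)
  have hb' : (lo + (hi - lo) - 1 - b) % (n + 1) = lo + (hi - lo) - 1 - b :=
    Nat.mod_eq_of_lt (by omega)
  simp only [Function.comp_apply, deltaGraph_adj_path_path, ne_eq, DeltaVertex.path.injEq,
    true_and, Fin.ext_iff, Fin.val_ofNat, ha', hb']
  omega

theorem spineVertex_eq {k : ℕ} (h : k < n + 2) : spineVertex m n k = .spine ⟨k, h⟩ := by
  unfold spineVertex
  congr 1
  exact Fin.ext (Nat.mod_eq_of_lt h)

/-- The extended star with centre `spine s` and the tendrils `path j i` for `s ≤ i < hi`, with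
vertices in `W` that are further to the right. -/
theorem CriticalSizes.starTree_pathSegments {t : MatchingTree (DeltaVertex m n)}
    {W : Set (DeltaVertex m n)} {N : Multiset ℕ} (ht : CriticalSizes (deltaGraph m n) t W N)
    (hm : m ≠ 0) {s hi len : ℕ} (hlen : len = hi - s) (hs : s ≤ hi) (hhi : hi ≤ n + 1)
    (hWs : ∀ k : Fin (n + 2), .spine k ∈ W → hi + 1 ≤ k)
    (hWp : ∀ (j : Fin m) (i : Fin (n + 1)), .path j i ∈ W → hi + 1 ≤ i) :
    CriticalSizes (deltaGraph m n)
      (MatchingTree.starTree (spineVertex m n s) (pathSegments m n s hi) len t)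
      {v | match v with
        | .spine k => (k : ℕ) = s ∨ .spine k ∈ W
        | .path j i => s ≤ i ∧ (i : ℕ) < hi ∨ .path j i ∈ W} (starSizes m len N) := by
  rw [pathSegments_eq s hi hhi, spineVertex_eq (show s < n + 2 by omega)]
  have h := ht.starTree (.spine ⟨s, by omega⟩) len ((List.finRange m).map (pathSegment n s hi))
    (by simpa using hm)
    (by
      simp only [List.forall_mem_map, length_pathSegment]
      exact fun _ _ => hlen.symm)
    (by
      simp only [List.forall_mem_map]
      exact fun j _ => ⟨isInducedPath_pathSegment hhi j, isInducedPath_reverse_pathSegment hhi j⟩)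
    (by
      rw [List.pairwise_map]
      refine (List.nodup_finRange m).imp fun {j j'} hj x hx y hy => ?_
      obtain ⟨i, rfl, -⟩ := (mem_pathSegment hhi).1 hx
      obtain ⟨i', rfl, -⟩ := (mem_pathSegment hhi).1 hy
      rw [deltaGraph_adj_path_path]
      simp [hj])
    (by
      simp only [List.forall_mem_map]
      intro j _ x hx
      obtain ⟨i, rfl, h1, h2⟩ := (mem_pathSegment hhi).1 hx
      refine ⟨fun h => ?_, fun w hw => ?_⟩
      · have := hWp _ _ h
        omega
      · rcases w with k | ⟨j', i'⟩
        · have := hWs _ hw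
          rw [deltaGraph_adj_path_spine]
          omega
        · have := hWp _ _ hw
          rw [deltaGraph_adj_path_path]
          omega)
    (by
      refine ⟨fun h => ?_, fun w hw => ?_⟩
      · have := hWs _ h
        simp only at this
        omega
      · rcases w with k | ⟨j', i'⟩
        · exact deltaGraph_adj_spine_spine
        · have := hWp _ _ hw
          rw [deltaGraph_adj_spine_path]
          simp only
          omega)
    (by
      simp only [List.forall_mem_map]
      intro j _ x hx
      obtain ⟨i, rfl, h1, h2⟩ := (mem_pathSegment hhi).1 hx
      rw [head?_pathSegment h2 h1, deltaGraph_adj_spine_path]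
      refine ⟨by simp, ?_⟩
      simp only
      omega)
  rw [List.length_map, List.length_finRange] at h
  refine h.of_eq ?_ rfl
  have hmem : ∀ w, (∃ l ∈ (List.finRange m).map (pathSegment n s hi), w ∈ l) ↔
      ∃ j, ∃ i : Fin (n + 1), w = .path j i ∧ s ≤ i ∧ (i : ℕ) < hi := by
    intro w
    simp [mem_pathSegment hhi]
  intro w
  rw [Set.mem_ofPred_eq, Set.mem_ofPred_eq, hmem]
  rcases w with k | ⟨j, i⟩
  · simp [Fin.ext_iff]
  · simp only [reduceCtorEq, DeltaVertex.path.injEq, false_or]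
    refine or_congr_left ⟨fun h => ⟨j, i, ⟨rfl, rfl⟩, h⟩, ?_⟩
    rintro ⟨j', i', ⟨rfl, rfl⟩, h⟩
    exact h

end Segments

end MatchingTree

/-! ### Sizes of the critical faces -/

namespace MatchingTree

section Comb

variable {m n : ℕ}

/-- The vertices that are undecided at the beginning of `combTreeFrom m n s k`. -/
def combRegion (m n s k : ℕ) : Set (DeltaVertex m n) :=
  {v | match v with
    | .spine i => (i : ℕ) = s ∨ k ≤ i
    | .path _ i => s ≤ i}

theorem spine_mem_combRegion {s k : ℕ} {i : Fin (n + 2)} :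
    .spine i ∈ combRegion m n s k ↔ (i : ℕ) = s ∨ k ≤ i := Iff.rfl

theorem path_mem_combRegion {s k : ℕ} {j : Fin m} {i : Fin (n + 1)} :
    .path j i ∈ combRegion m n s k ↔ s ≤ i := Iff.rfl

theorem map_dropLast_pathSegments {lo hi : ℕ} (h : hi ≤ n + 1) :
    (pathSegments m n lo hi).map List.dropLast = pathSegments m n lo (hi - 1) := by
  rw [pathSegments_eq lo hi h, pathSegments_eq lo (hi - 1) (by omega), List.map_map]
  exact List.map_congr_left fun j _ => dropLast_pathSegment j

theorem CriticalSizes.hatTree (hm : m ≠ 0) {s : ℕ} (hs : s ≤ n) :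
    CriticalSizes (deltaGraph m n)
      (MatchingTree.hatTree (spineVertex m n s) (spineVertex m n (n + 1))
        (pathSegments m n s (n + 1)) (n + 1 - s))
      (combRegion m n s (n + 1))
      (starSizes m (n + 1 - s) {0} + (starSizes m (n - s) {0}).map (· + 1)) := by
  unfold MatchingTree.hatTree
  rw [map_dropLast_pathSegments le_rfl]
  have h1 := (CriticalSizes.leaf (G := deltaGraph m n)).starTree_pathSegments hm
    (len := n + 1 - s) rfl (by omega) le_rfl (by simp) (by simp)
  have h2 := (CriticalSizes.leaf (G := deltaGraph m n)).starTree_pathSegments hm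
    (s := s) (hi := n) (len := n - s) rfl (by omega) (by omega) (by simp) (by simp)
  rw [show n + 1 - s - 1 = n - s by omega, Nat.add_sub_cancel]
  rw [spineVertex_eq (show n + 1 < n + 2 by omega)]
  refine .split (spine_mem_combRegion.2 (Or.inr le_rfl)) (h1.of_eq ?_ rfl) (h2.of_eq ?_ rfl)
  · rintro (i | ⟨j, i⟩)
    · have := i.isLt
      simp only [Set.mem_ofPred_eq, spine_mem_combRegion, ne_eq, DeltaVertex.spine.injEq,
        Fin.ext_iff, Set.mem_empty_iff_false, or_false]
      omega
    · have := i.isLt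
      simp only [Set.mem_ofPred_eq, path_mem_combRegion, ne_eq, reduceCtorEq,
        Set.mem_empty_iff_false, or_false, not_false_eq_true, and_true]
      omega
  · rintro (i | ⟨j, i⟩)
    · have := i.isLt
      simp only [Set.mem_ofPred_eq, spine_mem_combRegion, ne_eq, DeltaVertex.spine.injEq,
        Fin.ext_iff, Set.mem_empty_iff_false, or_false, deltaGraph_adj_spine_spine,
        not_false_eq_true, and_true]
      omega
    · have := i.isLt
      simp only [Set.mem_ofPred_eq, path_mem_combRegion, ne_eq, reduceCtorEq,
        Set.mem_empty_iff_false, or_false, deltaGraph_adj_spine_path, not_false_eq_true,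
        true_and]
      omega

/-- The branch of the Comb Algorithm in which `spine k` is included after `spine (s + 1)`, …,
`spine (k - 1)` have been excluded, where `s + 1 < k < n`. -/
theorem CriticalSizes.comb_branch (hm : m ≠ 0) {s k : ℕ} (hsk : s + 1 < k) (hk : k < n)
    {N : Multiset ℕ} (h : CriticalSizes (deltaGraph m n) (combTreeFrom m n (k + 1) (k + 2))
      (combRegion m n (k + 1) (k + 2)) N) :
    CriticalSizes (deltaGraph m n)
      (MatchingTree.starTree (spineVertex m n s) (pathSegments m n s (k - 1)) (k - 1 - s)
        (combTreeFrom m n (k + 1) (k + 2)))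
      {w | w ∈ combRegion m n s k ∧ w ≠ spineVertex m n k ∧
        ¬ (deltaGraph m n).Adj (spineVertex m n k) w} (starSizes m (k - 1 - s) N) := by
  rw [spineVertex_eq (show k < n + 2 by omega)]
  refine (h.starTree_pathSegments hm (hi := k - 1) rfl (by omega) (by omega) ?_ ?_).of_eq ?_ rfl
  · intro i hi
    rw [spine_mem_combRegion] at hi
    omega
  · intro j i hi
    rw [path_mem_combRegion] at hi
    omega
  · rintro (i | ⟨j, i⟩)
    · have := i.isLt
      simp only [Set.mem_ofPred_eq, spine_mem_combRegion, ne_eq, DeltaVertex.spine.injEq,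
        Fin.ext_iff, deltaGraph_adj_spine_spine, not_false_eq_true,
        and_true]
      omega
    · have := i.isLt
      simp only [Set.mem_ofPred_eq, path_mem_combRegion, ne_eq, reduceCtorEq,
        deltaGraph_adj_spine_path, not_false_eq_true,
        true_and]
      omega

/-- The branches of the Comb Algorithm with a free vertex `spine q`: either `q = s` and
`k = s + 1`, or `q = n + 1` and `k = n`.  All neighbours of `spine q` are then neighbours of
`spine k` or have been decided before. -/
theorem CriticalSizes.comb_free {s k q : ℕ} (hsk : s < k) (hk : k ≤ n)
    (hq : q = s ∧ k = s + 1 ∨ q = n + 1 ∧ k = n) :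
    CriticalSizes (deltaGraph m n) (.free (spineVertex m n q))
      {w | w ∈ combRegion m n s k ∧ w ≠ spineVertex m n k ∧
        ¬ (deltaGraph m n).Adj (spineVertex m n k) w} 0 := by
  rw [spineVertex_eq (show k < n + 2 by omega), spineVertex_eq (show q < n + 2 by omega)]
  refine .free ⟨?_, ?_, deltaGraph_adj_spine_spine⟩ ?_
  · rw [spine_mem_combRegion]
    simp only
    omega
  · rw [Ne, DeltaVertex.spine.injEq, Fin.ext_iff]
    simp only
    omega
  · rintro (i | ⟨j, i⟩)
    · exact fun _ => deltaGraph_adj_spine_spine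
    · have := i.isLt
      simp only [Set.mem_ofPred_eq, path_mem_combRegion, ne_eq, reduceCtorEq,
        deltaGraph_adj_spine_path, not_false_eq_true,
        true_and]
      omega

/-- The size `d + 1` of the critical face in dimension `d = ⌊(2 n + 2) / 3⌋`, if there is one. -/
def specialSizes (n : ℕ) : Multiset ℕ :=
  if n % 3 = 2 then 0 else {n + 1 - n / 3}

theorem starSizes_zero_singleton (m q : ℕ) : starSizes m (3 * q) {0} = 0 := by
  simp [starSizes]

theorem starSizes_one_singleton (m q : ℕ) : starSizes m (3 * q + 1) {0} = {m * q + 1} := by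
  simp [starSizes, show (3 * q + 1) % 3 = 1 by omega, show (3 * q + 1) / 3 = q by omega]

theorem starSizes_two_singleton (m q : ℕ) : starSizes m (3 * q + 2) {0} = {m * (q + 1)} := by
  simp [starSizes, show (3 * q + 2) % 3 = 2 by omega, show (3 * q + 2 + 1) / 3 = q + 1 by omega]

/-- The sizes for the graph that consists of two vertices and `m` paths between them: the critical
face of the special size occurs for paths of at most two vertices. -/
theorem hat_sizes (hm : 4 ≤ m) (n : ℕ) :
    ∃ R : Multiset ℕ, starSizes m (n + 1) {0} + (starSizes m n {0}).map (· + 1) =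
      (if n ≤ 1 then specialSizes n else 0) + R ∧ ∀ r ∈ R, n + 3 - n / 3 ≤ r := by
  obtain ⟨q, hq⟩ : ∃ q, n = 3 * q ∨ n = 3 * q + 1 ∨ n = 3 * q + 2 := ⟨n / 3, by omega⟩
  have hmq : 4 * q ≤ m * q := Nat.mul_le_mul_right q hm
  rcases hq with rfl | rfl | rfl
  · rw [starSizes_one_singleton, starSizes_zero_singleton]
    rcases Nat.eq_zero_or_pos q with rfl | hq
    · exact ⟨0, by simp [specialSizes], by simp⟩
    · refine ⟨{m * q + 1}, ?_, ?_⟩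
      · rw [if_neg (by omega)]
        simp
      · simp only [Multiset.mem_singleton, forall_eq]
        omega
  · rw [starSizes_two_singleton, starSizes_one_singleton]
    rcases Nat.eq_zero_or_pos q with rfl | hq
    · refine ⟨{m}, ?_, ?_⟩
      · simp [specialSizes, add_comm]
      · simp only [Multiset.mem_singleton, forall_eq]
        omega
    · refine ⟨{m * (q + 1)} + {m * q + 1 + 1}, ?_, ?_⟩
      · rw [if_neg (by omega)]
        simp
      · simp only [Multiset.mem_add, Multiset.mem_singleton]
        rintro r (rfl | rfl)
        · rw [mul_add]
          omega
        · omega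
  · rw [show 3 * q + 2 + 1 = 3 * (q + 1) by ring, starSizes_zero_singleton,
      starSizes_two_singleton]
    refine ⟨{m * (q + 1) + 1}, ?_, ?_⟩
    · rw [if_neg (by omega)]
      simp
    · simp only [Multiset.mem_singleton, forall_eq]
      rw [mul_add]
      omega

/-- If the first vertex included is `spine (s + 2)`, the star has tendrils of one vertex and
contributes one vertex, which together with `spine (s + 2)` raises all sizes by two. -/
theorem comb_sizes_two {n : ℕ} {R : Multiset ℕ} (hR : ∀ r ∈ R, n + 3 - n / 3 ≤ r) :
    ∃ R' : Multiset ℕ, (starSizes m 1 (specialSizes n + R)).map (· + 1) =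
      specialSizes (n + 3) + R' ∧ ∀ r ∈ R', n + 3 + 3 - (n + 3) / 3 ≤ r := by
  refine ⟨R.map (· + 2), ?_, ?_⟩
  · have h : (starSizes m 1 (specialSizes n + R)).map (· + 1) =
        (specialSizes n + R).map (· + 2) := by
      simp [starSizes, Multiset.map_map]
    rw [h, Multiset.map_add]
    congr 1
    unfold specialSizes
    rw [show (n + 3) % 3 = n % 3 by omega]
    split_ifs
    · rfl
    · rw [Multiset.map_singleton]
      congr 1
      omega
  · simp only [Multiset.mem_map]
    rintro _ ⟨r, hr, rfl⟩
    have := hR r hr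
    omega

/-- A star with tendrils of `len ≥ 2` vertices raises all sizes so much that they stay away from the
special size. -/
theorem comb_sizes_of_two_le (hm : 4 ≤ m) {len n : ℕ} (hlen : 2 ≤ len) {R : Multiset ℕ}
    (hR : ∀ r ∈ R, n + 3 - n / 3 ≤ r) :
    ∀ r ∈ (starSizes m len (specialSizes n + R)).map (· + 1),
      n + len + 2 + 3 - (n + len + 2) / 3 ≤ r := by
  intro r hr
  obtain ⟨r', hr', rfl⟩ := Multiset.mem_map.1 hr
  clear hr
  unfold starSizes at hr'
  split_ifs at hr' with h0 h1
  · simp at hr'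
  all_goals
    obtain ⟨x, hx, rfl⟩ := Multiset.mem_map.1 hr'
    have h : n + 1 - n / 3 ≤ x ∧ (n % 3 = 2 → n + 3 - n / 3 ≤ x) := by
      rcases Multiset.mem_add.1 hx with hx | hx
      · unfold specialSizes at hx
        split_ifs at hx with h2
        · simp at hx
        · rw [Multiset.mem_singleton] at hx
          omega
      · have := hR x hx
        omega
  · have h4 : 4 * (len / 3) ≤ m * (len / 3) := Nat.mul_le_mul_right _ hm
    omega
  · have h4 : 4 * ((len + 1) / 3) ≤ m * ((len + 1) / 3) := Nat.mul_le_mul_right _ hm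
    omega

/-- The critical faces of the Comb Algorithm, started at `spine s` on a copy of `Δ^m_{n-s}`: apart
from at most one face of the special size, all have at least two vertices more.  The special face
arises before `spine (s + 3)` is considered. -/
theorem exists_criticalSizes_combTreeFrom (hm : 4 ≤ m) (s k : ℕ) (hsk : s < k)
    (hk : k ≤ n + 1) :
    ∃ R : Multiset ℕ, CriticalSizes (deltaGraph m n) (combTreeFrom m n s k) (combRegion m n s k)
      ((if k ≤ s + 2 then specialSizes (n - s) else 0) + R) ∧
      ∀ r ∈ R, (n - s) + 3 - (n - s) / 3 ≤ r := by
  have hm0 : m ≠ 0 := by omega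
  rw [combTreeFrom]
  by_cases hkn : k ≤ n
  · rw [if_pos hkn]
    obtain ⟨R₁, h₁, hR₁⟩ := exists_criticalSizes_combTreeFrom hm s (k + 1) (by omega) (by omega)
    have hl : CriticalSizes (deltaGraph m n) (combTreeFrom m n s (k + 1))
        {w | w ∈ combRegion m n s k ∧ w ≠ spineVertex m n k}
        ((if k + 1 ≤ s + 2 then specialSizes (n - s) else 0) + R₁) := by
      refine h₁.of_eq ?_ rfl
      rw [spineVertex_eq (show k < n + 2 by omega)]
      rintro (i | ⟨j, i⟩)
      · have := i.isLt
        simp only [Set.mem_ofPred_eq, spine_mem_combRegion, ne_eq, DeltaVertex.spine.injEq,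
          Fin.ext_iff]
        omega
      · simp only [Set.mem_ofPred_eq, path_mem_combRegion, ne_eq, reduceCtorEq,
          not_false_eq_true, and_true]
    have hv : spineVertex m n k ∈ combRegion m n s k := by
      rw [spineVertex_eq (show k < n + 2 by omega)]
      exact spine_mem_combRegion.2 (Or.inr le_rfl)
    by_cases h1 : k = s + 1
    · rw [if_pos h1]
      refine ⟨R₁, (CriticalSizes.split hv hl
        (.comb_free hsk hkn (Or.inl ⟨rfl, h1⟩))).of_sizes_eq ?_, hR₁⟩
      simp [h1]
    rw [if_neg (show ¬ k + 1 ≤ s + 2 by omega), zero_add] at hl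
    rw [if_neg h1]
    by_cases h2 : k = n
    · rw [if_pos h2]
      refine ⟨R₁, (CriticalSizes.split hv hl
        (.comb_free hsk hkn (Or.inr ⟨rfl, h2⟩))).of_sizes_eq ?_, hR₁⟩
      -- Here `spine (s + 2)` is the last vertex before `b` only if `n - s = 2`, and then there is
      -- no special size.
      by_cases h3 : k ≤ s + 2
      · rw [if_pos h3, show n - s = 2 by omega]
        simp [specialSizes]
      · simp [h3]
    rw [if_neg h2]
    obtain ⟨R₂, h₂, hR₂⟩ :=
      exists_criticalSizes_combTreeFrom hm (k + 1) (k + 2) (by omega) (by omega)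
    rw [if_pos (by omega)] at h₂
    have hs := CriticalSizes.split hv hl (h₂.comb_branch hm0 (by omega) (by omega))
    by_cases h3 : k = s + 2
    · obtain ⟨R₃, h₃, hR₃⟩ := comb_sizes_two (m := m) hR₂
      rw [show n - (k + 1) + 3 = n - s by omega] at h₃ hR₃
      refine ⟨R₁ + R₃, hs.of_sizes_eq ?_, ?_⟩
      · rw [if_pos (by omega), show k - 1 - s = 1 by omega, h₃, add_left_comm]
      · exact fun r hr => (Multiset.mem_add.1 hr).elim (hR₁ r) (hR₃ r)
    · refine ⟨R₁ + (starSizes m (k - 1 - s) (specialSizes (n - (k + 1)) + R₂)).map (· + 1),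
        hs.of_sizes_eq ?_, ?_⟩
      · rw [if_neg (by omega), zero_add]
      · intro r hr
        rcases Multiset.mem_add.1 hr with hr | hr
        · exact hR₁ r hr
        · have := comb_sizes_of_two_le hm (by omega) hR₂ r hr
          rwa [show n - (k + 1) + (k - 1 - s) + 2 = n - s by omega] at this
  · obtain rfl : k = n + 1 := by omega
    rw [if_neg hkn]
    obtain ⟨R, hR, hR'⟩ := hat_sizes hm (n - s)
    refine ⟨R, (CriticalSizes.hatTree hm0 (by omega)).of_sizes_eq ?_, hR'⟩
    rw [show n + 1 - s = n - s + 1 by omega, hR]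
    congr 1
    exact if_congr (by omega) rfl rfl
termination_by n + 1 - k

/-- The critical faces of the Comb Algorithm for `Δ^m_n` as a finite set `K`.  With
`d = ⌊(2 n + 2) / 3⌋` we have `n + 3 - n / 3 = d + 3`, so that the faces counted by `R` have
dimension at least `d + 2`. -/
theorem exists_critical_combTree (hm : 4 ≤ m) (n : ℕ) :
    ∃ (K : Finset (Finset (DeltaVertex m n))) (R : Multiset ℕ),
      K.val.map Finset.card = specialSizes n + R ∧ (∀ r ∈ R, n + 3 - n / 3 ≤ r) ∧
        ∀ σ, σ ∈ K ↔ (combTree m n).Critical (deltaGraph m n) σ := by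
  obtain ⟨R, h, hR⟩ := exists_criticalSizes_combTreeFrom (n := n) hm 0 1 (by omega) (by omega)
  obtain ⟨K, hK, hK'⟩ := h.exists_critical ∅ (by simp [SimpleGraph.isIndepSet_iff]) (by simp)
    (by simp)
  refine ⟨K, R, by simpa using hK, hR, fun σ => ?_⟩
  rw [hK' σ, Finset.empty_union]
  refine and_iff_right ?_
  rintro (i | ⟨j, i⟩) -
  · rw [spine_mem_combRegion]
    omega
  · rw [path_mem_combRegion]
    omega

end Comb

end MatchingTree

section Conclusion

variable {m : ℕ}

/-- In the relevant range, the only critical face with `c` vertices is the one of the special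
size. -/
theorem exists_critical_card (hm : 4 ≤ m) (n c : ℕ) (hc : c < n + 3 - n / 3) :
    ∃ K : Finset (Finset (DeltaVertex m n)),
      (∀ σ, σ ∈ K ↔ (MatchingTree.combTree m n).Critical (deltaGraph m n) σ ∧ σ.card = c) ∧
        K.card = if n % 3 ≠ 2 ∧ c = n + 1 - n / 3 then 1 else 0 := by
  obtain ⟨K, R, hK, hR, hK'⟩ := MatchingTree.exists_critical_combTree hm n
  refine ⟨K.filter (·.card = c), fun σ => by rw [Finset.mem_filter, hK'], ?_⟩
  have h : (K.filter (·.card = c)).card = (K.val.map Finset.card).count c := by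
    rw [Multiset.count_map]
    simp only [Finset.card_def, Finset.filter_val, eq_comm]
    rfl
  have hRc : R.count c = 0 := by
    rw [Multiset.count_eq_zero]
    intro h
    have := hR c h
    omega
  rw [h, hK, Multiset.count_add, hRc, add_zero, MatchingTree.specialSizes]
  by_cases h2 : n % 3 = 2
  · simp [h2]
  · simp [h2, Multiset.count_singleton]

theorem numCombCells_eq (hm : 4 ≤ m) (n c : ℕ) (hc : c < n + 3 - n / 3) (d : ℤ)
    (hd : (c : ℤ) = d + 1) :
    numCombCells m n d = if n % 3 ≠ 2 ∧ c = n + 1 - n / 3 then 1 else 0 := by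
  obtain ⟨K, hK, hcard⟩ := exists_critical_card hm n c hc
  rw [← hcard, numCombCells, ← Set.ncard_coe_finset]
  congr 1
  ext σ
  rw [Finset.mem_coe, hK, Set.mem_ofPred_eq, ← hd, Nat.cast_inj]

theorem criticalChains_eq_bot (hm : 4 ≤ m) (n c : ℕ) (hc : c < n + 3 - n / 3)
    (h : ¬ (n % 3 ≠ 2 ∧ c = n + 1 - n / 3)) :
    (MatchingTree.combTree m n).criticalChains (deltaGraph m n) c = ⊥ := by
  obtain ⟨K, hK, hcard⟩ := exists_critical_card hm n c hc
  rw [if_neg h, Finset.card_eq_zero] at hcard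
  rw [MatchingTree.criticalChains, ← Finsupp.supported_empty]
  congr 1
  ext σ
  simpa [hcard] using (hK σ).symm

theorem nonempty_criticalChains_equiv (hm : 4 ≤ m) (n : ℕ) (h : n % 3 ≠ 2) :
    Nonempty ((MatchingTree.combTree m n).criticalChains (deltaGraph m n) (n + 1 - n / 3) ≃ₗ[ℤ]
      ℤ) := by
  obtain ⟨K, hK, hcard⟩ := exists_critical_card hm n (n + 1 - n / 3) (by omega)
  rw [if_pos ⟨h, rfl⟩, Finset.card_eq_one] at hcard
  obtain ⟨σ₀, rfl⟩ := hcard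
  have hs : {σ : Finset (DeltaVertex m n) |
      (MatchingTree.combTree m n).Critical (deltaGraph m n) σ ∧ σ.card = n + 1 - n / 3} = {σ₀} := by
    ext σ
    rw [Set.mem_ofPred_eq, ← hK, Finset.mem_singleton, Set.mem_singleton_iff]
  rw [MatchingTree.criticalChains, hs]
  exact ⟨(Finsupp.supportedEquivFinsupp {σ₀}).trans (Finsupp.uniqueLinearEquiv ℤ ℤ ⟨σ₀, rfl⟩)⟩

theorem mainTheorem2 (m n d : ℕ) (hm : 4 ≤ m) (hd : d = (2 * n + 2) / 3) :
    (n % 3 = 0 ∨ n % 3 = 1 →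
      Nonempty (reducedHomology (combComplex m n) d ≃ₗ[ℤ] ℤ) ∧
      Nonempty (reducedHomology (indComplex (deltaGraph m n)) d ≃ₗ[ℤ] ℤ) ∧
      numCombCells m n d = 1 ∧ numCombCells m n (d - 1) = 0 ∧ numCombCells m n (d + 1) = 0) ∧
    (n % 3 = 2 →
      Subsingleton (reducedHomology (combComplex m n) d) ∧
      Subsingleton (reducedHomology (indComplex (deltaGraph m n)) d) ∧
      numCombCells m n d = 0) := by
  constructor
  · intro h
    have hc : d + 1 = n + 1 - n / 3 := by omega
    have hlow := criticalChains_eq_bot hm n d (by omega) (by omega)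
    have hhigh := criticalChains_eq_bot hm n (d + 2) (by omega) (by omega)
    obtain ⟨e⟩ := nonempty_criticalChains_equiv hm n (by omega)
    rw [← hc] at e
    obtain ⟨e₁⟩ := MatchingTree.nonempty_morseComplex_homology_equiv _ _ d (Or.inr ⟨hlow, hhigh⟩)
    obtain ⟨e₂⟩ := MatchingTree.nonempty_indComplex_homology_equiv _ _ d (Or.inr ⟨hlow, hhigh⟩)
    refine ⟨⟨e₁.trans e⟩, ⟨e₂.trans e⟩, ?_, ?_, ?_⟩
    · rw [numCombCells_eq hm n (d + 1) (by omega) d (by simp), if_pos (by omega)]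
    · rw [numCombCells_eq hm n d (by omega) (d - 1) (by simp), if_neg (by omega)]
    · rw [numCombCells_eq hm n (d + 2) (by omega) (d + 1) (by push_cast; ring), if_neg (by omega)]
  · intro h
    have hbot := criticalChains_eq_bot hm n (d + 1) (by omega) (by omega)
    obtain ⟨e₁⟩ := MatchingTree.nonempty_morseComplex_homology_equiv _ _ d (Or.inl hbot)
    obtain ⟨e₂⟩ := MatchingTree.nonempty_indComplex_homology_equiv _ _ d (Or.inl hbot)
    rw [hbot] at e₁ e₂
    refine ⟨e₁.toEquiv.subsingleton, e₂.toEquiv.subsingleton, ?_⟩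
    rw [numCombCells_eq hm n (d + 1) (by omega) d (by simp), if_neg (by omega)]

end Conclusion
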